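/- Let $k$ be a field of characteristic $0$ and $\mathrm{pt}=\operatorname{Spec} k$. For $n,N\ge 0$ let $\tau_{n,N}$ be the total space of the tautological rank-$n$ bundle over the Grassmannian $Gr_{n,N}$ of rank-$n$ quotients of $\mathcal O^N$; thus a morphism $W\to\tau_{n,N}$ is an epimorphism $\mathcal O_W^N\twoheadrightarrow E$ onto a locally free sheaf of rank $n$ together with a section $s\in\Gamma(W,E)$, up to isomorphism. For $k$-schemes $X,Y$, an explicit cobordism-framed correspondence of level $(n,N)$ from $X$ to $Y$ is a tuple $(Z,W,\phi,g)$, where $Z\subseteq\mathbb A^n_X$ is a closed subset finite over $X$, $W\to\mathbb A^n_X$ is an étale neighbourhood of $Z$ (an étale morphism with $W\times_{\mathbb A^n_X}Z\cong Z$), $\phi\colon W\to\tau_{n,N}$ is a morphism such that $Z\subseteq W$ is, as a set, the preimage of the zero section, and $g\colon W\to Y$ is a $k$-morphism. Two such tuples with the same $Z$ are identified if they agree on a common refinement of their étale neighbourhoods; $Fr^{cob}_{n,N}(X,Y)$ is the set of classes. Let $Fr^{cob}(X,Y)$ be the colimit of these sets along the stabilisation maps $(n,N)\to(n,N+1)$,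 which replace $(\mathcal O^N\twoheadrightarrow E,s)$ by $(\mathcal O^{N+1}\twoheadrightarrow E,s)$ with zero last coordinate, and $(n,N)\to(n+1,N+1)$, which send $(Z,W,\phi,g)$ to $(\{0\}\times Z,\ \mathbb A^1\times W,\ (\mathcal O\oplus\mathcal O^N\twoheadrightarrow\mathcal O\oplus E,(x,s)),\ g\circ pr_2)$, where $x$ is the coordinate on $\mathbb A^1$. Let $\mathbb ZF^{cob}(X,Y)$ be the abelian group generated by $Fr^{cob}(X,Y)$ with the relations $[(Z,W,\phi,g)]+[(Z',W',\phi',g')]=[(Z\amalg Z',W\amalg W',\phi\amalg\phi',g\amalg g')]$ for disjoint supports, and let $H^0(C_*\mathbb ZF^{cob}(\mathrm{pt},Y))$ be the homology in degree $0$ of the alternating-sum complex of the simplicial abelian group $p\mapsto\mathbb ZF^{cob}(\Delta^p_k,Y)$, where $\Delta^p_k=\operatorname{Spec}k[t_0,\dots,t_p]/(\sum t_i-1)$. A $k$-morphism $f\colon X\to Y$ is regarded as the correspondence $(X,X,\mathcal O^0\twoheadrightarrow 0,f)$ of level $(0,0)$. **Proposition.** Let $Y$ be an open subscheme of an affine space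 $\mathbb A^m_k$, and let $(Z,W,\phi,g)$ be an explicit cobordism-framed correspondence of some level $(n,N)$ from $\mathrm{pt}$ to $Y$ whose support $Z$ is a single rational point (that is, $Z\cong\operatorname{Spec}k$ over $k$) and such that $\phi$ meets the zero section of $\tau_{n,N}$ transversally at $Z$. Then $(Z,W,\phi,g)$ and the level-$0$ correspondence given by the morphism $g|_Z\colon \mathrm{pt}\cong Z\to Y$ have the same class in $H^0(C_*\mathbb ZF^{cob}(\mathrm{pt},Y))$. -/

import Mathlib

open CategoryTheory CategoryTheory.Limits AlgebraicGeometry Opposite TopologicalSpace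

universe u

noncomputable section

namespace CobFramed

/-- Restriction of functions to a smaller open subset. -/
def res {W : Scheme.{u}} {U V : W.Opens} (h : V ≤ U) : Γ(W, U) →+* Γ(W, V) :=
  (W.presheaf.map (homOfLE h).op).hom

/-- Pull-back of functions on an open subset along a morphism. -/
def pullFun {W' W : Scheme.{u}} (f : W' ⟶ W) (U : W.Opens) : Γ(W, U) →+* Γ(W', f ⁻¹ᵁ U) :=
  (f.app U).hom

lemma res_pullFun {W' W : Scheme.{u}} (f : W' ⟶ W) {U V : W.Opens} (h : V ≤ U)
    (h' : f ⁻¹ᵁ V ≤ f ⁻¹ᵁ U) (s : Γ(W, U)) :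
    res h' (pullFun f U s) = pullFun f V (res h s) := by
  have := f.naturality (homOfLE h).op
  exact (congr($(this).hom s)).symm

/-- The block matrix with blocks `1` and `A` on the diagonal. -/
def blockOne {R : Type*} [CommRing R] {n m : ℕ} (A : Matrix (Fin n) (Fin m) R) :
    Matrix (Fin (n + 1)) (Fin (m + 1)) R :=
  Fin.cons (Fin.cons 1 0) fun p => Fin.cons 0 (A p)

section blockOne

variable {R : Type*} [CommRing R] {n m l : ℕ}

@[simp] lemma blockOne_zero_zero (A : Matrix (Fin n) (Fin m) R) : blockOne A 0 0 = 1 := rfl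
@[simp] lemma blockOne_zero_succ (A : Matrix (Fin n) (Fin m) R) (q : Fin m) :
    blockOne A 0 q.succ = 0 := rfl
@[simp] lemma blockOne_succ_zero (A : Matrix (Fin n) (Fin m) R) (p : Fin n) :
    blockOne A p.succ 0 = 0 := rfl
@[simp] lemma blockOne_succ_succ (A : Matrix (Fin n) (Fin m) R) (p : Fin n) (q : Fin m) :
    blockOne A p.succ q.succ = A p q := rfl

lemma blockOne_mul (A : Matrix (Fin n) (Fin m) R) (B : Matrix (Fin m) (Fin l) R) :
    blockOne (A * B) = blockOne A * blockOne B := by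
  ext p q
  rw [Matrix.mul_apply, Fin.sum_univ_succ]
  refine Fin.cases ?_ (fun p => ?_) p <;> refine Fin.cases ?_ (fun q => ?_) q <;>
    simp [Matrix.mul_apply]

lemma blockOne_one : blockOne (1 : Matrix (Fin n) (Fin n) R) = 1 := by
  ext p q
  refine Fin.cases ?_ (fun p => ?_) p <;> refine Fin.cases ?_ (fun q => ?_) q <;>
    simp [Matrix.one_apply, Fin.succ_ne_zero, (Fin.succ_ne_zero _).symm]

lemma isUnit_blockOne {g : Matrix (Fin n) (Fin n) R} (hg : IsUnit g) : IsUnit (blockOne g) := by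
  obtain ⟨u, rfl⟩ := hg
  exact ⟨⟨blockOne u.val, blockOne u.inv, by rw [← blockOne_mul, u.val_inv, blockOne_one],
    by rw [← blockOne_mul, u.inv_val, blockOne_one]⟩, rfl⟩

lemma blockOne_map {S : Type*} [CommRing S] (f : R →+* S) (A : Matrix (Fin n) (Fin m) R) :
    (blockOne A).map f = blockOne (A.map f) := by
  ext p q
  refine Fin.cases ?_ (fun p => ?_) p <;> refine Fin.cases ?_ (fun q => ?_) q <;> simp

lemma blockOne_agree {S T : Type*} [CommRing S] [CommRing T] {f : R →+* T} {f' : S →+* T}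
    {A : Matrix (Fin n) (Fin m) R} {A' : Matrix (Fin n) (Fin m) S} {g : Matrix (Fin n) (Fin n) T}
    (h : ∀ p q, f' (A' p q) = ∑ r, g p r * f (A r q)) (p : Fin (n + 1)) (q : Fin (m + 1)) :
    f' (blockOne A' p q) = ∑ r, blockOne g p r * f (blockOne A r q) := by
  rw [Fin.sum_univ_succ]
  revert p q
  refine Fin.cases (Fin.cases ?_ fun q => ?_) (fun p => Fin.cases ?_ fun q => ?_) <;> simp [h]

lemma cons_agree {S T : Type*} [CommRing S] [CommRing T] {f : R →+* T} {f' : S →+* T}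
    {v : Fin n → R} {v' : Fin n → S} {t : R} {t' : S} {g : Matrix (Fin n) (Fin n) T}
    (ht : f' t' = f t) (h : ∀ p, f' (v' p) = ∑ r, g p r * f (v r)) (p : Fin (n + 1)) :
    f' (Fin.cons (α := fun _ => S) t' v' p) =
      ∑ r, blockOne g p r * f (Fin.cons (α := fun _ => R) t v r) := by
  rw [Fin.sum_univ_succ]
  revert p
  refine Fin.cases ?_ fun p => ?_ <;> simp [h, ht]

end blockOne

/-- The matrix `(A | 0)` obtained from `A` by adding a last column of zeros. -/
def padZero {R : Type*} [CommRing R] {n m : ℕ} (A : Matrix (Fin n) (Fin m) R) :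
    Matrix (Fin n) (Fin (m + 1)) R :=
  Matrix.of fun p => Fin.snoc (α := fun _ => R) (A p) 0

section padZero

variable {R : Type*} [CommRing R] {n m : ℕ}

@[simp] lemma padZero_castSucc (A : Matrix (Fin n) (Fin m) R) (p : Fin n) (q : Fin m) :
    padZero A p q.castSucc = A p q := by simp [padZero]
@[simp] lemma padZero_last (A : Matrix (Fin n) (Fin m) R) (p : Fin n) :
    padZero A p (Fin.last m) = 0 := by simp [padZero]

lemma padZero_epi {A : Matrix (Fin n) (Fin m) R} (h : ∃ B : Matrix (Fin m) (Fin n) R, A * B = 1) :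
    ∃ B : Matrix (Fin (m + 1)) (Fin n) R, padZero A * B = 1 := by
  obtain ⟨B, hB⟩ := h
  refine ⟨(padZero B.transpose).transpose, ?_⟩
  ext p q
  rw [Matrix.mul_apply, Fin.sum_univ_castSucc, ← hB, Matrix.mul_apply]
  simp

lemma padZero_map {S : Type*} [CommRing S] (f : R →+* S) (A : Matrix (Fin n) (Fin m) R) :
    (padZero A).map f = padZero (A.map f) := by
  ext p q
  refine Fin.lastCases ?_ (fun q => ?_) q <;> simp

lemma padZero_agree {S T : Type*} [CommRing S] [CommRing T] {f : R →+* T} {f' : S →+* T}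
    {A : Matrix (Fin n) (Fin m) R} {A' : Matrix (Fin n) (Fin m) S} {g : Matrix (Fin n) (Fin n) T}
    (h : ∀ p q, f' (A' p q) = ∑ r, g p r * f (A r q)) (p : Fin n) (q : Fin (m + 1)) :
    f' (padZero A' p q) = ∑ r, g p r * f (padZero A r q) := by
  refine Fin.lastCases ?_ (fun q => ?_) q <;> simp [h]

end padZero

/-- A trivialised piece of a map `W ⟶ τ_{n,N}`: on the open subset `U`, an epimorphism
`A : 𝒪^N ↠ 𝒪^n` (given by a right invertible matrix) together with a section `v` of `𝒪^n`. -/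
structure LocalQuot (W : Scheme.{u}) (n N : ℕ) where
  U : W.Opens
  A : Matrix (Fin n) (Fin N) Γ(W, U)
  v : Fin n → Γ(W, U)
  epi : ∃ B : Matrix (Fin N) (Fin n) Γ(W, U), A * B = 1

namespace LocalQuot

variable {W W' W'' : Scheme.{u}} {n N : ℕ}

/-- Over `a.U ⊓ b.U` the two quotients with section are isomorphic: an invertible matrix `g`
(which is unique, `A` being right invertible) satisfies `b.A = g * a.A` and `b.v = g * a.v`. -/
def Agree (a b : LocalQuot W n N) : Prop :=
  ∃ g : Matrix (Fin n) (Fin n) Γ(W, a.U ⊓ b.U), IsUnit g ∧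
    (∀ p q, res (inf_le_right : a.U ⊓ b.U ≤ b.U) (b.A p q) =
      ∑ r, g p r * res (inf_le_left : a.U ⊓ b.U ≤ a.U) (a.A r q)) ∧
    (∀ p, res (inf_le_right : a.U ⊓ b.U ≤ b.U) (b.v p) =
      ∑ r, g p r * res (inf_le_left : a.U ⊓ b.U ≤ a.U) (a.v r))

lemma Agree.refl (a : LocalQuot W n N) : a.Agree a := by
  refine ⟨1, isUnit_one, fun p q => ?_, fun p => ?_⟩ <;> simp [Matrix.one_apply]

/-- Pull-back of a trivialised piece. -/
def pull (f : W' ⟶ W) (a : LocalQuot W n N) : LocalQuot W' n N where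
  U := f ⁻¹ᵁ a.U
  A := a.A.map (pullFun f a.U)
  v p := pullFun f a.U (a.v p)
  epi := by
    obtain ⟨B, hB⟩ := a.epi
    refine ⟨B.map (pullFun f a.U), ?_⟩
    rw [← Matrix.map_mul, hB, Matrix.map_one _ (map_zero _) (map_one _)]

lemma Agree.pull (f : W' ⟶ W) {a b : LocalQuot W n N} (h : a.Agree b) :
    (a.pull f).Agree (b.pull f) := by
  obtain ⟨g, hg, hA, hv⟩ := h
  refine ⟨g.map (pullFun f (a.U ⊓ b.U)), hg.map (pullFun f (a.U ⊓ b.U)).mapMatrix,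
    fun p q => ?_, fun p => ?_⟩
  · have h2 := congr_arg (pullFun f (a.U ⊓ b.U)) (hA p q)
    rw [map_sum] at h2
    simp only [map_mul] at h2
    refine (res_pullFun f _ _ _).trans (h2.trans (Finset.sum_congr rfl fun x _ => ?_))
    exact congr_arg _ (res_pullFun f _ _ _).symm
  · have h2 := congr_arg (pullFun f (a.U ⊓ b.U)) (hv p)
    rw [map_sum] at h2
    simp only [map_mul] at h2
    refine (res_pullFun f (inf_le_right : a.U ⊓ b.U ≤ b.U) (fun _ hx => hx.2) (b.v p)).trans
      (h2.trans (Finset.sum_congr rfl fun x _ => ?_))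
    exact congr_arg _ (res_pullFun f (inf_le_left : a.U ⊓ b.U ≤ a.U) (fun _ hx => hx.1) (a.v x)).symm

lemma pull_pull (f : W' ⟶ W) (f' : W'' ⟶ W') (a : LocalQuot W n N) :
    (a.pull f).pull f' = a.pull (f' ≫ f) := by
  rcases a with ⟨U, A, v, h⟩
  simp only [pull, LocalQuot.mk.injEq]
  refine ⟨rfl, heq_of_eq ?_, heq_of_eq ?_⟩
  · ext i j
    simp [pullFun]
    rfl
  · funext i
    simp [pullFun]
    rfl

lemma pull_id (a : LocalQuot W n N) : a.pull (𝟙 W) = a := by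
  rcases a with ⟨U, A, v, h⟩
  simp only [pull, LocalQuot.mk.injEq]
  refine ⟨rfl, heq_of_eq ?_, heq_of_eq ?_⟩
  · ext i j
    simp [pullFun]
    rfl
  · funext i
    simp [pullFun]
    rfl


/-- `(A, v) ↦ ((A | 0), v)`: the new epimorphism vanishes on the last coordinate. -/
def stabLast (a : LocalQuot W n N) : LocalQuot W n (N + 1) where
  U := a.U
  A := padZero a.A
  v := a.v
  epi := padZero_epi a.epi

lemma Agree.stabLast {a b : LocalQuot W n N} (h : a.Agree b) : a.stabLast.Agree b.stabLast := by
  obtain ⟨g, hg, hA, hv⟩ := h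
  exact ⟨g, hg, padZero_agree hA, hv⟩

lemma pull_stabLast (f : W' ⟶ W) (a : LocalQuot W n N) :
    a.stabLast.pull f = (a.pull f).stabLast := by
  simp only [pull, stabLast]
  congr 1
  exact padZero_map _ _

/-- `(A, v) ↦ (1 ⊕ A, (t, v))`, for a global function `t`. -/
def stabFirst (t : Γ(W, ⊤)) (a : LocalQuot W n N) : LocalQuot W (n + 1) (N + 1) where
  U := a.U
  A := blockOne a.A
  v := Fin.cons (res le_top t) a.v
  epi := by
    obtain ⟨B, hB⟩ := a.epi
    exact ⟨blockOne B, by rw [← blockOne_mul, hB, blockOne_one]⟩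

lemma res_res {U V V' : W.Opens} (h : V ≤ U) (h' : V' ≤ V) (s : Γ(W, U)) :
    res h' (res h s) = res (h'.trans h) s := by
  simp only [res, ← CommRingCat.comp_apply, ← Functor.map_comp]
  rfl

lemma Agree.stabFirst (t : Γ(W, ⊤)) {a b : LocalQuot W n N} (h : a.Agree b) :
    (a.stabFirst t).Agree (b.stabFirst t) := by
  obtain ⟨g, hg, hA, hv⟩ := h
  exact ⟨blockOne g, isUnit_blockOne hg, blockOne_agree hA,
    cons_agree ((res_res _ _ _).trans (res_res _ _ _).symm) hv⟩

lemma pull_stabFirst (f : W' ⟶ W) (t : Γ(W, ⊤)) (a : LocalQuot W n N) :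
    (a.stabFirst t).pull f = (a.pull f).stabFirst (f.appTop t) := by
  simp only [pull, stabFirst]
  congr 1
  · exact blockOne_map _ _
  · funext p
    refine Fin.cases ?_ (fun p => ?_) p
    · exact (res_pullFun f _ _ _).symm
    · rfl

end LocalQuot

/-- A morphism from `W` to the total space `τ_{n,N}` of the tautological rank `n` bundle on the
Grassmannian of rank `n` quotients of `𝒪^N`, described through the functor which `τ_{n,N}`
represents: an epimorphism `𝒪_W^N ↠ E` onto a locally free sheaf of rank `n` together with a
section `s ∈ Γ(W, E)`. The pair `(𝒪_W^N ↠ E, s)` is given by trivialisations of `E` over the members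
of an open cover, any two of which differ by an invertible matrix on the overlap. Two such
descriptions define the same morphism to `τ_{n,N}` when the pairs are isomorphic,
see `TautMap.Same`. -/
structure TautMap (W : Scheme.{u}) (n N : ℕ) where
  ι : Type u
  chart : ι → LocalQuot W n N
  cover : ∀ x : W, ∃ i, x ∈ (chart i).U
  compat : ∀ i j, (chart i).Agree (chart j)

namespace TautMap

variable {W W' W'' : Scheme.{u}} {n N : ℕ}

/-- `φ` and `ψ` are the same morphism to `τ_{n,N}`, that is, the pairs `(𝒪^N ↠ E, s)` which they
describe are isomorphic (local isomorphisms of quotients of `𝒪^N` are unique, so they glue). -/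
def Same (φ ψ : TautMap W n N) : Prop := ∀ i j, (φ.chart i).Agree (ψ.chart j)

lemma Same.refl (φ : TautMap W n N) : φ.Same φ := φ.compat

lemma Same.of_eq {φ ψ : TautMap W n N} (h : φ = ψ) : φ.Same ψ := h ▸ .refl φ

/-- The composite of a morphism `W' ⟶ W` with `φ : W ⟶ τ_{n,N}`. -/
def pull (f : W' ⟶ W) (φ : TautMap W n N) : TautMap W' n N where
  ι := φ.ι
  chart i := (φ.chart i).pull f
  cover x := φ.cover (f x)
  compat i j := (φ.compat i j).pull f

lemma Same.pull (f : W' ⟶ W) {φ ψ : TautMap W n N} (h : φ.Same ψ) : (φ.pull f).Same (ψ.pull f) :=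
  fun i j => (h i j).pull f

lemma pull_pull (f : W' ⟶ W) (f' : W'' ⟶ W') (φ : TautMap W n N) :
    (φ.pull f).pull f' = φ.pull (f' ≫ f) := by
  simp only [pull, LocalQuot.pull_pull]

lemma pull_id (φ : TautMap W n N) : φ.pull (𝟙 W) = φ := by
  simp only [pull, LocalQuot.pull_id]

/-- The set-theoretic preimage of the zero section: the points where all components of the section
`s` vanish (`basicOpen` is the locus where a function does not vanish). -/
def zeroLocus (φ : TautMap W n N) : Set W :=
  {x | ∀ i p, x ∉ W.basicOpen ((φ.chart i).v p)}

lemma zeroLocus_pull (f : W' ⟶ W) (φ : TautMap W n N) :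
    (φ.pull f).zeroLocus = f ⁻¹' φ.zeroLocus := by
  ext x
  simp only [zeroLocus, Set.mem_ofPred_eq, Set.mem_preimage]
  refine forall_congr' fun i => forall_congr' fun p => not_congr ?_
  exact (iff_of_eq congr(x ∈ $(Scheme.preimage_basicOpen f ((φ.chart i).v p)))).symm

/-- The composite with `τ_{n,N} ⟶ τ_{n,N+1}`, `(𝒪^N ↠ E, s) ↦ (𝒪^N ⊕ 𝒪 ↠ E, s)`. -/
def stabLast (φ : TautMap W n N) : TautMap W n (N + 1) where
  ι := φ.ι
  chart i := (φ.chart i).stabLast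
  cover := φ.cover
  compat i j := (φ.compat i j).stabLast

lemma Same.stabLast {φ ψ : TautMap W n N} (h : φ.Same ψ) : φ.stabLast.Same ψ.stabLast :=
  fun i j => (h i j).stabLast

lemma pull_stabLast (f : W' ⟶ W) (φ : TautMap W n N) :
    φ.stabLast.pull f = (φ.pull f).stabLast := by
  simp only [pull, stabLast, LocalQuot.pull_stabLast]

lemma zeroLocus_stabLast (φ : TautMap W n N) : φ.stabLast.zeroLocus = φ.zeroLocus := rfl

/-- `(𝒪^N ↠ E, s) ↦ (𝒪 ⊕ 𝒪^N ↠ 𝒪 ⊕ E, (t, s))`. -/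
def stabFirst (t : Γ(W, ⊤)) (φ : TautMap W n N) : TautMap W (n + 1) (N + 1) where
  ι := φ.ι
  chart i := (φ.chart i).stabFirst t
  cover := φ.cover
  compat i j := (φ.compat i j).stabFirst t

lemma Same.stabFirst (t : Γ(W, ⊤)) {φ ψ : TautMap W n N} (h : φ.Same ψ) :
    (φ.stabFirst t).Same (ψ.stabFirst t) :=
  fun i j => (h i j).stabFirst t

lemma pull_stabFirst (f : W' ⟶ W) (t : Γ(W, ⊤)) (φ : TautMap W n N) :
    (φ.stabFirst t).pull f = (φ.pull f).stabFirst (f.appTop t) := by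
  simp only [pull, stabFirst, LocalQuot.pull_stabFirst]

lemma zeroLocus_stabFirst (t : Γ(W, ⊤)) (φ : TautMap W n N) :
    (φ.stabFirst t).zeroLocus = φ.zeroLocus ∩ {x | x ∉ W.basicOpen t} := by
  ext x
  simp only [zeroLocus, Set.mem_ofPred_eq, Set.mem_inter_iff]
  have key (i) : x ∈ W.basicOpen (((φ.chart i).stabFirst t).v 0) ↔
      x ∈ (φ.chart i).U ∧ x ∈ W.basicOpen t := by
    have := Scheme.basicOpen_res W t (homOfLE (le_top : (φ.chart i).U ≤ ⊤)).op
    exact iff_of_eq congr(x ∈ $this)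
  constructor
  · intro h
    obtain ⟨j, hj⟩ := φ.cover x
    exact ⟨fun i p => h i p.succ, fun hx => h j 0 ((key j).2 ⟨hj, hx⟩)⟩
  · rintro ⟨h, h'⟩ i p
    refine Fin.cases (fun hx => h' ((key i).1 hx).2) (fun p => h i p) p

/-- The only morphism to `τ_{0,0}`. -/
def triv (W : Scheme.{u}) : TautMap W 0 0 where
  ι := PUnit
  chart _ := ⟨⊤, 0, 0, 0, Subsingleton.elim _ _⟩
  cover _ := ⟨⟨⟩, trivial⟩
  compat _ _ := .refl _

end TautMap

/-- Affine `n`-space over `X`. -/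
abbrev Aff (n : ℕ) (X : Scheme.{u}) : Scheme.{u} := 𝔸(ULift.{u} (Fin n); X)

/-- The projection of affine space over `X` to `X`. -/
abbrev affProj (n : ℕ) (X : Scheme.{u}) : Aff n X ⟶ X := 𝔸(ULift.{u} (Fin n); X) ↘ X

/-- A closed subset with its reduced subscheme structure. -/
abbrev redSub {A : Scheme.{u}} (Z : Closeds A) : Scheme.{u} :=
  (Scheme.IdealSheafData.vanishingIdeal Z).subscheme

/-- The inclusion of a closed subset with its reduced subscheme structure. -/
def redι {A : Scheme.{u}} (Z : Closeds A) : redSub Z ⟶ A :=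
  (Scheme.IdealSheafData.vanishingIdeal Z).subschemeι

instance {A : Scheme.{u}} (Z : Closeds A) : IsClosedImmersion (redι Z) := by
  unfold redι; infer_instance

lemma range_redι {A : Scheme.{u}} (Z : Closeds A) : Set.range (redι Z) = Z := by
  unfold redι
  rw [Scheme.IdealSheafData.range_subschemeι]
  rfl

lemma exists_lift_of_subset_range {A T : Scheme.{u}} (Z : Closeds A) (t : T ⟶ A)
    [IsClosedImmersion t] (h : (Z : Set A) ⊆ Set.range t) :
    ∃ l : redSub Z ⟶ T, l ≫ t = redι Z ∧ IsClosedImmersion l := by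
  have hk : t.ker ≤ (redι Z).ker := by
    unfold redι
    rw [Scheme.IdealSheafData.ker_subschemeι,
      ← Scheme.IdealSheafData.le_support_iff_le_vanishingIdeal]
    intro x hx
    have : x ∈ (t.ker.support : Set A) := by
      rw [Scheme.Hom.support_ker]
      exact subset_closure (h hx)
    exact this
  refine ⟨IsClosedImmersion.lift t (redι Z) hk, IsClosedImmersion.lift_fac _ _ _, ?_⟩
  have : IsClosedImmersion (IsClosedImmersion.lift t (redι Z) hk ≫ t) := by
    rw [IsClosedImmersion.lift_fac]; infer_instance
  exact IsClosedImmersion.of_comp_isClosedImmersion _ t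

/-- `e : W ⟶ A` is an étale neighbourhood of the closed subset `Z` of `A`: `e` is étale and
`W ×_A Z ⟶ Z` is an isomorphism. -/
structure IsEtaleNhd {W A : Scheme.{u}} (e : W ⟶ A) (Z : Closeds A) : Prop where
  etale : Etale e
  isIso : IsIso (pullback.snd e (redι Z))

lemma IsEtaleNhd.baseChange {W A A' : Scheme.{u}} {e : W ⟶ A} {Z : Closeds A}
    (h : IsEtaleNhd e Z) (b : A' ⟶ A) (Z' : Closeds A') (hZ : ∀ x ∈ Z', b x ∈ Z) :
    IsEtaleNhd (pullback.snd e b) Z' := by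
  obtain ⟨h1, h2⟩ := h
  refine ⟨inferInstance, ?_⟩
  obtain ⟨l, hl, -⟩ := exists_lift_of_subset_range Z' (pullback.snd (redι Z) b) (by
    rw [Scheme.Pullback.range_snd, range_redι]
    exact hZ)
  have hl' : l ≫ pullback.fst (redι Z) b ≫ redι Z = redι Z' ≫ b := by
    rw [pullback.condition, reassoc_of% hl]
  have sq1 : IsPullback (pullback.fst (pullback.snd e b) (redι Z') ≫ pullback.fst e b)
      (pullback.snd (pullback.snd e b) (redι Z')) e (redι Z' ≫ b) :=
    (IsPullback.of_hasPullback (pullback.snd e b) (redι Z')).flip.paste_vert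
      (IsPullback.of_hasPullback e b).flip |>.flip
  have sq2 : IsPullback (pullback.fst e (redι Z)) (pullback.snd e (redι Z)) e (redι Z) :=
    IsPullback.of_hasPullback _ _
  rw [← hl', ← Category.assoc] at sq1
  let d : pullback (pullback.snd e b) (redι Z') ⟶ pullback e (redι Z) :=
    pullback.lift (pullback.fst (pullback.snd e b) (redι Z') ≫ pullback.fst e b)
      (pullback.snd (pullback.snd e b) (redι Z') ≫ l ≫ pullback.fst (redι Z) b)
      (by rw [sq1.w]; simp)
  have hd1 : d ≫ pullback.fst e (redι Z) =
    pullback.fst (pullback.snd e b) (redι Z') ≫ pullback.fst e b := pullback.lift_fst _ _ _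
  have hd2 : d ≫ pullback.snd e (redι Z) =
    pullback.snd (pullback.snd e b) (redι Z') ≫ l ≫ pullback.fst (redι Z) b :=
      pullback.lift_snd _ _ _
  rw [← hd1] at sq1
  have sq3 := IsPullback.of_right sq1 hd2 sq2
  exact MorphismProperty.of_isPullback (P := .isomorphisms _) sq3 h2

/-- The first coordinate function on affine space. -/
def firstCoord (n : ℕ) (X : Scheme.{u}) : Γ(Aff (n + 1) X, ⊤) := AffineSpace.coord X ⟨0⟩

/-- The projection forgetting the first coordinate. -/
def dropFirst (n : ℕ) (X : Scheme.{u}) : Aff (n + 1) X ⟶ Aff n X :=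
  AffineSpace.reindex (fun i => ⟨i.down.succ⟩) X

/-- The embedding of affine `n`-space as the locus where the first coordinate vanishes. -/
def zeroFirst (n : ℕ) (X : Scheme.{u}) : Aff n X ⟶ Aff (n + 1) X :=
  AffineSpace.homOfVector (affProj n X)
    (fun i => Fin.cases (motive := fun _ => Γ(Aff n X, ⊤)) 0 (fun j => AffineSpace.coord X ⟨j⟩) i.down)

/-- The image of `Z` under the embedding `zeroFirst`. -/
def stabZ {n : ℕ} {X : Scheme.{u}} (Z : Closeds (Aff n X)) : Closeds (Aff (n + 1) X) where
  carrier := {x | dropFirst n X x ∈ Z ∧ x ∉ (Aff (n + 1) X).basicOpen (firstCoord n X)}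
  isClosed' := (Z.isClosed.preimage (dropFirst n X).continuous).inter
    ((Aff (n + 1) X).basicOpen (firstCoord n X)).isOpen.isClosed_compl

lemma dropFirst_coord (n : ℕ) (X : Scheme.{u}) (i : ULift.{u} (Fin n)) :
    (dropFirst n X).appTop (AffineSpace.coord X i) = AffineSpace.coord X ⟨i.down.succ⟩ :=
  AffineSpace.reindex_appTop_coord _ _ _

lemma dropFirst_proj (n : ℕ) (X : Scheme.{u}) :
    dropFirst n X ≫ affProj n X = affProj (n + 1) X := AffineSpace.reindex_over _ _

lemma zeroFirst_proj (n : ℕ) (X : Scheme.{u}) :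
    zeroFirst n X ≫ affProj (n + 1) X = affProj n X := AffineSpace.homOfVector_over _ _

lemma zeroFirst_coord_zero (n : ℕ) (X : Scheme.{u}) :
    (zeroFirst n X).appTop (AffineSpace.coord X ⟨0⟩) = 0 :=
  AffineSpace.homOfVector_appTop_coord _ _ _

lemma zeroFirst_coord_succ (n : ℕ) (X : Scheme.{u}) (i : Fin n) :
    (zeroFirst n X).appTop (AffineSpace.coord X ⟨i.succ⟩) = AffineSpace.coord X ⟨i⟩ :=
  AffineSpace.homOfVector_appTop_coord _ _ _

lemma zeroFirst_dropFirst (n : ℕ) (X : Scheme.{u}) : zeroFirst n X ≫ dropFirst n X = 𝟙 _ := by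
  refine AffineSpace.hom_ext ?_ fun i => ?_
  · rw [Category.assoc, dropFirst_proj, zeroFirst_proj, Category.id_comp]
  · rw [Scheme.Hom.comp_appTop, CommRingCat.comp_apply, dropFirst_coord, zeroFirst_coord_succ]
    simp

instance (n : ℕ) (X : Scheme.{u}) : IsClosedImmersion (zeroFirst n X) := by
  have h1 : IsSeparated (dropFirst n X) := by
    have : IsSeparated (dropFirst n X ≫ affProj n X) := by
      rw [dropFirst_proj]; infer_instance
    exact .of_comp _ (affProj n X)
  have : IsClosedImmersion (zeroFirst n X ≫ dropFirst n X) := by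
    rw [zeroFirst_dropFirst]; infer_instance
  exact IsClosedImmersion.of_comp _ (dropFirst n X)

lemma mem_range_zeroFirst {n : ℕ} {X : Scheme.{u}} {x : Aff (n + 1) X}
    (hx : x ∉ (Aff (n + 1) X).basicOpen (firstCoord n X)) : x ∈ Set.range (zeroFirst n X) := by
  set r := (Aff (n + 1) X).fromSpecResidueField x with hr
  have hrange : Set.range r = {x} := (Aff (n + 1) X).range_fromSpecResidueField x
  have h0 : r.appTop (firstCoord n X) = 0 := by
    rw [← basicOpen_eq_bot_iff]
    have := Scheme.preimage_basicOpen r (firstCoord n X)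
    refine this.symm.trans ?_
    ext y
    have hy : r y = x := by
      have : r y ∈ Set.range r := ⟨y, rfl⟩
      rwa [hrange] at this
    simp only [Opens.coe_bot, Set.mem_empty_iff_false, iff_false]
    intro h
    have h' : r y ∈ (Aff (n + 1) X).basicOpen (firstCoord n X) := h
    rw [hy] at h'
    exact hx h'
  have key : (r ≫ dropFirst n X) ≫ zeroFirst n X = r := by
    refine AffineSpace.hom_ext ?_ fun i => ?_
    · simp only [Category.assoc]
      rw [zeroFirst_proj, dropFirst_proj]
    · obtain ⟨i⟩ := i
      rw [Scheme.Hom.comp_appTop, Scheme.Hom.comp_appTop, CommRingCat.comp_apply,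
        CommRingCat.comp_apply]
      refine Fin.cases ?_ (fun i => ?_) i
      · rw [zeroFirst_coord_zero, map_zero, map_zero]
        exact h0.symm
      · rw [zeroFirst_coord_succ, dropFirst_coord]
  obtain ⟨y, hy⟩ : x ∈ Set.range r := by rw [hrange]; rfl
  refine ⟨(r ≫ dropFirst n X) y, ?_⟩
  rw [← Scheme.Hom.comp_apply, key, hy]


/-- An explicit cobordism-framed correspondence `(Z, W, φ, g)` of level `(n, N)` from `X` to `Y`:
a closed subset `Z` of affine `n`-space over `X`, finite over `X`, an étale neighbourhood `W` of `Z`,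
a morphism `φ : W ⟶ τ_{n,N}` such that `Z`, as a subset of `W` (where it is the preimage of `Z`
under `e`), is the preimage of the zero section, and a morphism `g : W ⟶ Y` over the base. -/
structure ExplicitCob {S : Scheme.{u}} (n N : ℕ) (X Y : Over S) where
  Z : Closeds (Aff n X.left)
  finite : IsFinite (redι Z ≫ affProj n X.left)
  W : Scheme.{u}
  e : W ⟶ Aff n X.left
  nbhd : IsEtaleNhd e Z
  φ : TautMap W n N
  zero : φ.zeroLocus = e ⁻¹' Z
  g : W ⟶ Y.left
  g_over : g ≫ Y.hom = e ≫ affProj n X.left ≫ X.hom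

namespace ExplicitCob

variable {S : Scheme.{u}} {n N : ℕ} {X X' X'' Y : Over S}

/-- Equivalence of explicit correspondences: they have the same support, and agree on a common
refinement of the two étale neighbourhoods. -/
def Equivalent (c c' : ExplicitCob n N X Y) : Prop :=
  c.Z = c'.Z ∧ ∃ (W : Scheme.{u}) (i : W ⟶ c.W) (i' : W ⟶ c'.W),
    i ≫ c.e = i' ≫ c'.e ∧ IsEtaleNhd (i ≫ c.e) c.Z ∧
      (c.φ.pull i).Same (c'.φ.pull i') ∧ i ≫ c.g = i' ≫ c'.g

/-- `c = (Z₁ ⨿ Z₂, W₁ ⨿ W₂, φ₁ ⨿ φ₂, g₁ ⨿ g₂)`, where `cᵢ = (Zᵢ, Wᵢ, φᵢ, gᵢ)` and `Z₁ ∩ Z₂ = ∅`. -/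
structure IsSum (c₁ c₂ c : ExplicitCob n N X Y) : Prop where
  disjoint : Disjoint c₁.Z c₂.Z
  supp : c.Z = c₁.Z ⊔ c₂.Z
  sum : ∃ (j₁ : c₁.W ⟶ c.W) (j₂ : c₂.W ⟶ c.W), IsOpenImmersion j₁ ∧ IsOpenImmersion j₂ ∧
    IsCompl (Set.range j₁) (Set.range j₂) ∧ j₁ ≫ c.e = c₁.e ∧ j₂ ≫ c.e = c₂.e ∧
    (c.φ.pull j₁).Same c₁.φ ∧ (c.φ.pull j₂).Same c₂.φ ∧ j₁ ≫ c.g = c₁.g ∧ j₂ ≫ c.g = c₂.g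

/-- If there is a morphism of étale neighbourhoods compatible with the remaining data, then the
two explicit correspondences are equivalent. -/
lemma Equivalent.of_hom {c c' : ExplicitCob n N X Y} (hZ : c.Z = c'.Z) (i : c.W ⟶ c'.W)
    (he : c.e = i ≫ c'.e) (hφ : c.φ.Same (c'.φ.pull i)) (hg : c.g = i ≫ c'.g) :
    c.Equivalent c' :=
  ⟨hZ, c.W, 𝟙 _, i, by simpa using he, by simpa using c.nbhd, by rwa [TautMap.pull_id],
    by simpa using hg⟩

/-- The morphism of affine spaces induced by a morphism of bases. -/
abbrev affMap (n : ℕ) {X X' : Over S} (f : X' ⟶ X) : Aff n X'.left ⟶ Aff n X.left :=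
  AffineSpace.map (ULift.{u} (Fin n)) f.left

/-- The preimage of the support. -/
def pullZ (f : X' ⟶ X) (Z : Closeds (Aff n X.left)) : Closeds (Aff n X'.left) :=
  Z.preimage (affMap n f).continuous

lemma pullZ_finite (f : X' ⟶ X) (Z : Closeds (Aff n X.left))
    (hZ : IsFinite (redι Z ≫ affProj n X.left)) :
    IsFinite (redι (pullZ f Z) ≫ affProj n X'.left) := by
  obtain ⟨l, hl, hl'⟩ := exists_lift_of_subset_range (pullZ f Z)
    (pullback.snd (redι Z) (affMap n f)) (by
    rw [Scheme.Pullback.range_snd, range_redι]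
    exact fun _ h => h)
  rw [← hl, Category.assoc]
  have sq : IsPullback (pullback.fst (redι Z) (affMap n f))
      (pullback.snd (redι Z) (affMap n f) ≫ affProj n X'.left)
      (redι Z ≫ affProj n X.left) f.left :=
    (IsPullback.of_hasPullback (redι Z) (affMap n f)).paste_vert
      (AffineSpace.isPullback_map f.left)
  have : IsFinite (pullback.snd (redι Z) (affMap n f) ≫ affProj n X'.left) :=
    MorphismProperty.of_isPullback (P := @IsFinite) sq hZ
  infer_instance

/-- Pull-back of an explicit correspondence along a morphism `X' ⟶ X`. -/
def pull (f : X' ⟶ X) (c : ExplicitCob n N X Y) : ExplicitCob n N X' Y where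
  Z := pullZ f c.Z
  finite := pullZ_finite f c.Z c.finite
  W := pullback c.e (affMap n f)
  e := pullback.snd c.e (affMap n f)
  nbhd := c.nbhd.baseChange _ _ fun _ h => h
  φ := c.φ.pull (pullback.fst c.e (affMap n f))
  zero := by
    rw [TautMap.zeroLocus_pull, c.zero]
    ext x
    have : c.e (pullback.fst c.e (affMap n f) x) =
        affMap n f (pullback.snd c.e (affMap n f) x) := by
      rw [← Scheme.Hom.comp_apply, ← Scheme.Hom.comp_apply, pullback.condition]
    exact iff_of_eq congr($this ∈ c.Z)
  g := pullback.fst c.e (affMap n f) ≫ c.g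
  g_over := by
    rw [Category.assoc, c.g_over, pullback.condition_assoc, AffineSpace.map_over_assoc, Over.w]

/-- The projection from the pulled back neighbourhood. -/
def pullFst (f : X' ⟶ X) (c : ExplicitCob n N X Y) : (c.pull f).W ⟶ c.W :=
  pullback.fst c.e (affMap n f)

lemma pull_isPullback (f : X' ⟶ X) (c : ExplicitCob n N X Y) :
    IsPullback (c.pullFst f) (c.pull f).e c.e (affMap n f) :=
  IsPullback.of_hasPullback _ _

lemma pull_φ (f : X' ⟶ X) (c : ExplicitCob n N X Y) :
    (c.pull f).φ = c.φ.pull (c.pullFst f) := rfl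

lemma pull_g (f : X' ⟶ X) (c : ExplicitCob n N X Y) : (c.pull f).g = c.pullFst f ≫ c.g := rfl

lemma Equivalent.pull (f : X' ⟶ X) {c c' : ExplicitCob n N X Y} (h : c.Equivalent c') :
    (c.pull f).Equivalent (c'.pull f) := by
  obtain ⟨hZ, W, i, i', he, hW, hφ, hg⟩ := h
  let p₁ := pullback.fst (i ≫ c.e) (affMap n f)
  let p₂ := pullback.snd (i ≫ c.e) (affMap n f)
  have hp : p₁ ≫ i ≫ c.e = p₂ ≫ affMap n f := pullback.condition
  have h1 : (p₁ ≫ i) ≫ c.e = p₂ ≫ affMap n f := by rw [Category.assoc, hp]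
  have h2 : (p₁ ≫ i') ≫ c'.e = p₂ ≫ affMap n f := by rw [Category.assoc, ← he, hp]
  refine ⟨congr_arg (pullZ f) hZ, pullback (i ≫ c.e) (affMap n f),
    (c.pull_isPullback f).lift (p₁ ≫ i) p₂ h1, (c'.pull_isPullback f).lift (p₁ ≫ i') p₂ h2,
    ?_, ?_, ?_, ?_⟩
  · rw [IsPullback.lift_snd, IsPullback.lift_snd]
  · rw [IsPullback.lift_snd]
    exact hW.baseChange (affMap n f) (pullZ f c.Z) fun _ h => h
  · rw [pull_φ, pull_φ, TautMap.pull_pull, TautMap.pull_pull, IsPullback.lift_fst,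
      IsPullback.lift_fst, ← TautMap.pull_pull, ← TautMap.pull_pull]
    exact hφ.pull p₁
  · rw [pull_g, pull_g, IsPullback.lift_fst_assoc, IsPullback.lift_fst_assoc, Category.assoc,
      Category.assoc, hg]

/-- The restriction of an explicit correspondence along a morphism of neighbourhoods is compatible
with pull-back. -/
lemma exists_pull_open (f : X' ⟶ X) {c₁ c : ExplicitCob n N X Y} (j : c₁.W ⟶ c.W)
    [IsOpenImmersion j] (he : j ≫ c.e = c₁.e) (hφ : (c.φ.pull j).Same c₁.φ) (hg : j ≫ c.g = c₁.g) :
    ∃ j' : (c₁.pull f).W ⟶ (c.pull f).W, IsOpenImmersion j' ∧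
      Set.range j' = c.pullFst f ⁻¹' Set.range j ∧ j' ≫ (c.pull f).e = (c₁.pull f).e ∧
      ((c.pull f).φ.pull j').Same (c₁.pull f).φ ∧ j' ≫ (c.pull f).g = (c₁.pull f).g := by
  let j' := (c.pull_isPullback f).lift (c₁.pullFst f ≫ j) (c₁.pull f).e
    (by rw [Category.assoc, he, (c₁.pull_isPullback f).w])
  have h1 : j' ≫ c.pullFst f = c₁.pullFst f ≫ j := IsPullback.lift_fst _ _ _ _
  have h2 : j' ≫ (c.pull f).e = (c₁.pull f).e := IsPullback.lift_snd _ _ _ _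
  have sq : IsPullback j' (c₁.pullFst f) (c.pullFst f) j := by
    refine IsPullback.of_right (h₁₂ := (c.pull f).e) (h₂₂ := c.e) (v₁₃ := affMap n f) ?_ h1
      (c.pull_isPullback f).flip
    rw [h2, he]
    exact (c₁.pull_isPullback f).flip
  refine ⟨j', MorphismProperty.of_isPullback (P := @IsOpenImmersion) sq.flip inferInstance, ?_, h2,
    ?_, ?_⟩
  · have := Scheme.image_preimage_eq_of_isPullback sq.flip Set.univ
    simpa using this
  · rw [pull_φ, pull_φ, TautMap.pull_pull, h1, ← TautMap.pull_pull]
    exact hφ.pull _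
  · rw [pull_g, pull_g, reassoc_of% h1, hg]

lemma IsSum.pull (f : X' ⟶ X) {c₁ c₂ c : ExplicitCob n N X Y} (h : IsSum c₁ c₂ c) :
    IsSum (c₁.pull f) (c₂.pull f) (c.pull f) := by
  obtain ⟨hd, hs, j₁, j₂, h₁, h₂, hc, he₁, he₂, hφ₁, hφ₂, hg₁, hg₂⟩ := h
  obtain ⟨j₁', k₁, r₁, e₁, p₁, g₁⟩ := exists_pull_open f j₁ he₁ hφ₁ hg₁
  obtain ⟨j₂', k₂, r₂, e₂, p₂, g₂⟩ := exists_pull_open f j₂ he₂ hφ₂ hg₂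
  refine ⟨?_, ?_, j₁', j₂', k₁, k₂, ?_, e₁, e₂, p₁, p₂, g₁, g₂⟩
  · rw [disjoint_iff] at hd ⊢
    ext x
    have : affMap n f x ∉ c₁.Z ⊓ c₂.Z := by rw [hd]; exact fun h => h
    exact ⟨fun h => (this h).elim, fun h => h.elim⟩
  · change pullZ f c.Z = _
    rw [hs]
    rfl
  · rw [r₁, r₂]
    exact hc.map (CompleteLatticeHom.setPreimage (c.pullFst f))

lemma pull_id (c : ExplicitCob n N X Y) : (c.pull (𝟙 X)).Equivalent c := by
  have h1 : affMap n (𝟙 X) = 𝟙 _ := AffineSpace.map_id _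
  refine .of_hom ?_ (c.pullFst (𝟙 X)) ?_ (.refl _) rfl
  · ext x
    change affMap n (𝟙 X) x ∈ c.Z ↔ _
    rw [h1]
    rfl
  · rw [(c.pull_isPullback (𝟙 X)).w, h1]
    exact (Category.comp_id _).symm

lemma pull_pull (f : X' ⟶ X) (f' : X'' ⟶ X') (c : ExplicitCob n N X Y) :
    ((c.pull f).pull f').Equivalent (c.pull (f' ≫ f)) := by
  have h1 : affMap n (f' ≫ f) = affMap n f' ≫ affMap n f := AffineSpace.map_comp _ _
  have hw : ((c.pull f).pullFst f' ≫ c.pullFst f) ≫ c.e =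
      ((c.pull f).pull f').e ≫ affMap n (f' ≫ f) := by
    rw [Category.assoc, (c.pull_isPullback f).w, ← Category.assoc,
      ((c.pull f).pull_isPullback f').w, h1, Category.assoc]
  refine .of_hom ?_ ((c.pull_isPullback (f' ≫ f)).lift _ _ hw) ?_ ?_ ?_
  · ext x
    change affMap n f (affMap n f' x) ∈ c.Z ↔ affMap n (f' ≫ f) x ∈ c.Z
    rw [h1]
    rfl
  · rw [IsPullback.lift_snd]
  · refine .of_eq ?_
    simp only [pull_φ, TautMap.pull_pull, IsPullback.lift_fst]
  · rw [pull_g, pull_g, pull_g, IsPullback.lift_fst_assoc, Category.assoc]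

/-- Stabilisation along `N`. -/
def stabLast (c : ExplicitCob n N X Y) : ExplicitCob n (N + 1) X Y where
  __ := c
  φ := c.φ.stabLast
  zero := c.zero

lemma Equivalent.stabLast {c c' : ExplicitCob n N X Y} (h : c.Equivalent c') :
    c.stabLast.Equivalent c'.stabLast := by
  obtain ⟨hZ, W, i, i', he, hW, hφ, hg⟩ := h
  refine ⟨hZ, W, i, i', he, hW, ?_, hg⟩
  have := hφ.stabLast
  rwa [← TautMap.pull_stabLast, ← TautMap.pull_stabLast] at this

lemma pull_stabLast (f : X' ⟶ X) (c : ExplicitCob n N X Y) :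
    c.stabLast.pull f = (c.pull f).stabLast := by
  simp only [pull, stabLast, TautMap.pull_stabLast]

lemma stabZ_finite (Z : Closeds (Aff n X.left)) (hZ : IsFinite (redι Z ≫ affProj n X.left)) :
    IsFinite (redι (stabZ Z) ≫ affProj (n + 1) X.left) := by
  obtain ⟨l, hl, hl'⟩ := exists_lift_of_subset_range (stabZ Z)
    (redι Z ≫ zeroFirst n X.left) (by
    rintro x ⟨hx, hx'⟩
    obtain ⟨y, rfl⟩ := mem_range_zeroFirst hx'
    rw [← Scheme.Hom.comp_apply, zeroFirst_dropFirst] at hx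
    have : y ∈ Set.range (redι Z) := by rw [range_redι]; exact hx
    obtain ⟨z, rfl⟩ := this
    exact ⟨z, by simp⟩)
  rw [← hl, Category.assoc, Category.assoc, zeroFirst_proj]
  infer_instance

/-- Stabilisation along `n`: the neighbourhood is `𝔸¹ × W` (that is, the preimage of `W` in affine
`(n + 1)`-space), and `φ` is replaced by `(𝒪 ⊕ 𝒪^N ↠ 𝒪 ⊕ E, (x, s))`, with `x` the new coordinate,
which comes first. -/
def stabFirst (c : ExplicitCob n N X Y) : ExplicitCob (n + 1) (N + 1) X Y where
  Z := stabZ c.Z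
  finite := stabZ_finite c.Z c.finite
  W := pullback c.e (dropFirst n X.left)
  e := pullback.snd c.e (dropFirst n X.left)
  nbhd := c.nbhd.baseChange _ _ fun _ h => h.1
  φ := (c.φ.pull (pullback.fst c.e (dropFirst n X.left))).stabFirst
    ((pullback.snd c.e (dropFirst n X.left)).appTop (firstCoord n X.left))
  zero := by
    rw [TautMap.zeroLocus_stabFirst, TautMap.zeroLocus_pull, c.zero]
    ext x
    have h1 : c.e (pullback.fst c.e (dropFirst n X.left) x) =
        dropFirst n X.left (pullback.snd c.e (dropFirst n X.left) x) := by
      rw [← Scheme.Hom.comp_apply, ← Scheme.Hom.comp_apply, pullback.condition]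
    have h2 := Scheme.preimage_basicOpen (pullback.snd c.e (dropFirst n X.left))
      (firstCoord n X.left)
    exact and_congr (iff_of_eq congr($h1 ∈ c.Z)) (not_congr (iff_of_eq congr(x ∈ $h2.symm)))
  g := pullback.fst c.e (dropFirst n X.left) ≫ c.g
  g_over := by
    rw [Category.assoc, c.g_over, pullback.condition_assoc]
    have := dropFirst_proj n X.left
    rw [reassoc_of% this]

/-- The projection from the stabilised neighbourhood. -/
def stabFst (c : ExplicitCob n N X Y) : c.stabFirst.W ⟶ c.W :=
  pullback.fst c.e (dropFirst n X.left)

lemma stab_isPullback (c : ExplicitCob n N X Y) :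
    IsPullback c.stabFst c.stabFirst.e c.e (dropFirst n X.left) :=
  IsPullback.of_hasPullback _ _

lemma stab_φ (c : ExplicitCob n N X Y) : c.stabFirst.φ =
    (c.φ.pull c.stabFst).stabFirst (c.stabFirst.e.appTop (firstCoord n X.left)) := rfl

lemma stab_g (c : ExplicitCob n N X Y) : c.stabFirst.g = c.stabFst ≫ c.g := rfl

lemma pull_stab_φ (c : ExplicitCob n N X Y) {V : Scheme.{u}} (i : V ⟶ c.stabFirst.W) :
    c.stabFirst.φ.pull i = (c.φ.pull (i ≫ c.stabFst)).stabFirst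
      ((i ≫ c.stabFirst.e).appTop (firstCoord n X.left)) := by
  rw [stab_φ, TautMap.pull_stabFirst, TautMap.pull_pull, Scheme.Hom.comp_appTop]
  rfl

lemma Equivalent.stabFirst {c c' : ExplicitCob n N X Y} (h : c.Equivalent c') :
    c.stabFirst.Equivalent c'.stabFirst := by
  obtain ⟨hZ, W, i, i', he, hW, hφ, hg⟩ := h
  let p₁ := pullback.fst (i ≫ c.e) (dropFirst n X.left)
  let p₂ := pullback.snd (i ≫ c.e) (dropFirst n X.left)
  have hp : p₁ ≫ i ≫ c.e = p₂ ≫ dropFirst n X.left := pullback.condition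
  have h1 : (p₁ ≫ i) ≫ c.e = p₂ ≫ dropFirst n X.left := by rw [Category.assoc, hp]
  have h2 : (p₁ ≫ i') ≫ c'.e = p₂ ≫ dropFirst n X.left := by rw [Category.assoc, ← he, hp]
  refine ⟨congr_arg stabZ hZ, pullback (i ≫ c.e) (dropFirst n X.left),
    c.stab_isPullback.lift (p₁ ≫ i) p₂ h1, c'.stab_isPullback.lift (p₁ ≫ i') p₂ h2,
    ?_, ?_, ?_, ?_⟩
  · rw [IsPullback.lift_snd, IsPullback.lift_snd]
  · rw [IsPullback.lift_snd]
    exact hW.baseChange (dropFirst n X.left) (stabZ c.Z) fun _ h => h.1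
  · rw [pull_stab_φ, pull_stab_φ, IsPullback.lift_fst, IsPullback.lift_fst, IsPullback.lift_snd,
      IsPullback.lift_snd, ← TautMap.pull_pull, ← TautMap.pull_pull]
    exact (hφ.pull p₁).stabFirst _
  · rw [stab_g, stab_g, IsPullback.lift_fst_assoc, IsPullback.lift_fst_assoc, Category.assoc,
      Category.assoc, hg]

lemma pull_stabFirst (f : X' ⟶ X) (c : ExplicitCob n N X Y) :
    (c.stabFirst.pull f).Equivalent (c.pull f).stabFirst := by
  have hd : affMap (n + 1) f ≫ dropFirst n X.left = dropFirst n X'.left ≫ affMap n f :=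
    AffineSpace.map_reindex _ _
  have hc : (affMap (n + 1) f).appTop (firstCoord n X.left) = firstCoord n X'.left :=
    AffineSpace.map_appTop_coord _ _
  have w1 : (c.stabFirst.pullFst f ≫ c.stabFst) ≫ c.e =
      ((c.stabFirst.pull f).e ≫ dropFirst n X'.left) ≫ affMap n f := by
    rw [Category.assoc, c.stab_isPullback.w, ← Category.assoc, (c.stabFirst.pull_isPullback f).w,
      Category.assoc, Category.assoc, hd]
  let q := (c.pull_isPullback f).lift _ _ w1
  have hq1 : q ≫ c.pullFst f = c.stabFirst.pullFst f ≫ c.stabFst := IsPullback.lift_fst _ _ _ _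
  have hq2 : q ≫ (c.pull f).e = (c.stabFirst.pull f).e ≫ dropFirst n X'.left :=
    IsPullback.lift_snd _ _ _ _
  refine .of_hom ?_ ((c.pull f).stab_isPullback.lift q _ hq2) ?_ ?_ ?_
  · ext x
    refine and_congr ?_ (not_congr ?_)
    · change (affMap (n + 1) f ≫ dropFirst n X.left) x ∈ c.Z ↔
        (dropFirst n X'.left ≫ affMap n f) x ∈ c.Z
      rw [hd]
    · have := Scheme.preimage_basicOpen (affMap (n + 1) f) (firstCoord n X.left)
      have h2 := this.trans (congr_arg (Aff (n + 1) X'.left).basicOpen hc)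
      exact iff_of_eq congr(x ∈ $h2)
  · rw [IsPullback.lift_snd]
  · refine .of_eq ?_
    rw [pull_φ, pull_stab_φ, pull_stab_φ, IsPullback.lift_fst, IsPullback.lift_snd, pull_φ,
      TautMap.pull_pull, hq1, (c.stabFirst.pull_isPullback f).w]
    congr 1
    rw [← hc, Scheme.Hom.comp_appTop]
    rfl
  · rw [pull_g, stab_g, stab_g, IsPullback.lift_fst_assoc, pull_g, reassoc_of% hq1]

/-- The correspondence of level `0` given by a morphism `f : X ⟶ Y`. -/
def ofMap (f : X ⟶ Y) : ExplicitCob 0 0 X Y where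
  Z := ⊤
  finite := by infer_instance
  W := Aff 0 X.left
  e := 𝟙 _
  nbhd := ⟨inferInstance, inferInstance⟩
  φ := .triv _
  zero := by
    ext x
    exact ⟨fun _ => trivial, fun _ _ p => p.elim0⟩
  g := affProj 0 X.left ≫ f.left
  g_over := by simp

end ExplicitCob

section Groups

variable {S : Scheme.{u}}

/-- Cobordism-framed correspondences of level `(n, N)` from `X` to `Y`. -/
def Fr (n N : ℕ) (X Y : Over S) : Type (u + 1) :=
  Quot (ExplicitCob.Equivalent (n := n) (N := N) (X := X) (Y := Y))

namespace Fr

variable {n N : ℕ} {X X' X'' Y : Over S}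

/-- The class of an explicit correspondence. -/
def mk (c : ExplicitCob n N X Y) : Fr n N X Y := Quot.mk _ c

/-- Stabilisation along `N`. -/
def stabLast : Fr n N X Y → Fr n (N + 1) X Y :=
  Quot.map ExplicitCob.stabLast fun _ _ h => h.stabLast

/-- Stabilisation along `n`. -/
def stabFirst : Fr n N X Y → Fr (n + 1) (N + 1) X Y :=
  Quot.map ExplicitCob.stabFirst fun _ _ h => h.stabFirst

/-- Pull-back along a morphism `X' ⟶ X`. -/
def pull (f : X' ⟶ X) : Fr n N X Y → Fr n N X' Y :=
  Quot.map (ExplicitCob.pull f) fun _ _ h => h.pull f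

lemma pull_stabLast (f : X' ⟶ X) (a : Fr n N X Y) : a.stabLast.pull f = (a.pull f).stabLast := by
  obtain ⟨c⟩ := a
  exact congr_arg mk (c.pull_stabLast f)

lemma pull_stabFirst (f : X' ⟶ X) (a : Fr n N X Y) :
    a.stabFirst.pull f = (a.pull f).stabFirst := by
  obtain ⟨c⟩ := a
  exact Quot.sound (c.pull_stabFirst f)

lemma pull_id (a : Fr n N X Y) : a.pull (𝟙 X) = a := by
  obtain ⟨c⟩ := a
  exact Quot.sound c.pull_id

lemma pull_pull (f : X' ⟶ X) (f' : X'' ⟶ X') (a : Fr n N X Y) :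
    (a.pull f).pull f' = a.pull (f' ≫ f) := by
  obtain ⟨c⟩ := a
  exact Quot.sound (c.pull_pull f f')

end Fr

/-- Correspondences of all levels. (For `N < n` only the correspondence with empty support exists, so
these levels do not affect the colimit below.) -/
abbrev AllLevels (X Y : Over S) : Type (u + 1) := Sigma fun p : ℕ × ℕ => Fr p.1 p.2 X Y

/-- The stabilisation maps, as a relation between correspondences of all levels. -/
inductive StabStep (X Y : Over S) : AllLevels X Y → AllLevels X Y → Prop
  | last {n N : ℕ} (a : Fr n N X Y) : StabStep X Y ⟨(n, N), a⟩ ⟨(n, N + 1), a.stabLast⟩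
  | first {n N : ℕ} (a : Fr n N X Y) : StabStep X Y ⟨(n, N), a⟩ ⟨(n + 1, N + 1), a.stabFirst⟩

/-- Stable cobordism-framed correspondences: the colimit along the stabilisation maps. -/
def StableFr (X Y : Over S) : Type (u + 1) := Quot (StabStep X Y)

namespace StableFr

variable {X X' X'' Y : Over S}

/-- The stable class of a correspondence of finite level. -/
def mk {n N : ℕ} (a : Fr n N X Y) : StableFr X Y := Quot.mk _ ⟨(n, N), a⟩

/-- Pull-back along a morphism `X' ⟶ X`. -/
def pull (f : X' ⟶ X) : StableFr X Y → StableFr X' Y :=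
  Quot.map (fun a => ⟨a.1, a.2.pull f⟩) fun _ _ h => by
    cases h with
    | last a => simpa [Fr.pull_stabLast] using StabStep.last (a.pull f)
    | first a => simpa [Fr.pull_stabFirst] using StabStep.first (a.pull f)

lemma pull_id (a : StableFr X Y) : a.pull (𝟙 X) = a := by
  obtain ⟨p, a⟩ := a
  exact congr_arg mk a.pull_id

lemma pull_pull (f : X' ⟶ X) (f' : X'' ⟶ X') (a : StableFr X Y) :
    (a.pull f).pull f' = a.pull (f' ≫ f) := by
  obtain ⟨p, a⟩ := a
  exact congr_arg mk (a.pull_pull f f')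

end StableFr

/-- The generator given by an explicit correspondence. -/
def gen {n N : ℕ} {X Y : Over S} (c : ExplicitCob n N X Y) : FreeAbelianGroup (StableFr X Y) :=
  .of (.mk (.mk c))

/-- The subgroup generated by the additivity relations `[c₁] + [c₂] = [c₁ ⨿ c₂]`. -/
def additivity (X Y : Over S) : AddSubgroup (FreeAbelianGroup (StableFr X Y)) :=
  .closure {x | ∃ (n N : ℕ) (c₁ c₂ c : ExplicitCob n N X Y),
    ExplicitCob.IsSum c₁ c₂ c ∧ x = gen c₁ + gen c₂ - gen c}

/-- The group of linear stable cobordism-framed correspondences. -/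
abbrev ZF (X Y : Over S) : Type (u + 1) := FreeAbelianGroup (StableFr X Y) ⧸ additivity X Y

namespace ZF

variable {X X' X'' Y : Over S}

/-- The class of an explicit correspondence. -/
def cls {n N : ℕ} (c : ExplicitCob n N X Y) : ZF X Y := QuotientAddGroup.mk (gen c)

/-- Pull-back along a morphism `X' ⟶ X`. -/
def pull (f : X' ⟶ X) : ZF X Y →+ ZF X' Y :=
  QuotientAddGroup.map _ _ (FreeAbelianGroup.map (StableFr.pull f)) <| by
    rw [additivity, AddSubgroup.closure_le]
    rintro _ ⟨n, N, c₁, c₂, c, h, rfl⟩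
    refine AddSubgroup.subset_closure ⟨n, N, _, _, _, h.pull f, ?_⟩
    simp only [map_add, map_sub, gen, FreeAbelianGroup.map_of_apply]
    rfl

lemma pull_id : pull (Y := Y) (𝟙 X) = AddMonoidHom.id _ := by
  refine QuotientAddGroup.addMonoidHom_ext _ (FreeAbelianGroup.lift_ext _ _ fun a => ?_)
  have := StableFr.pull_id a
  simp [pull, this]

lemma pull_comp (f : X' ⟶ X) (f' : X'' ⟶ X') :
    pull (Y := Y) (f' ≫ f) = (pull f').comp (pull f) := by
  refine QuotientAddGroup.addMonoidHom_ext _ (FreeAbelianGroup.lift_ext _ _ fun a => ?_)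
  have := StableFr.pull_pull f f' a
  simp [pull, this]

/-- The presheaf of abelian groups `X ↦ ℤF(X, Y)`. -/
def functor (Y : Over S) : (Over S)ᵒᵖ ⥤ AddCommGrpCat.{u + 1} where
  obj X := .of (ZF X.unop Y)
  map f := AddCommGrpCat.ofHom (pull f.unop)
  map_id X := by
    rw [unop_id, pull_id]; rfl
  map_comp f g := by
    rw [unop_comp, pull_comp]; rfl

end ZF

end Groups

section Simplex

variable (k : Type u) [Field k]

/-- The ring `k[t₀, …, tₚ]/(t₀ + ⋯ + tₚ - 1)`. -/
abbrev simplexRing (p : ℕ) : Type u :=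
  MvPolynomial (Fin (p + 1)) k ⧸ Ideal.span {∑ i, MvPolynomial.X i - (1 : MvPolynomial (Fin (p + 1)) k)}

/-- The barycentric coordinates. -/
def simplexRing.t {p : ℕ} (i : Fin (p + 1)) : simplexRing k p := Ideal.Quotient.mk _ (MvPolynomial.X i)

lemma simplexRing.sum_t (p : ℕ) : ∑ i, simplexRing.t k (p := p) i = 1 := by
  have : Ideal.Quotient.mk (Ideal.span {∑ i, MvPolynomial.X i - (1 : MvPolynomial (Fin (p + 1)) k)})
      (∑ i, MvPolynomial.X i - 1) = 0 :=
    Ideal.Quotient.eq_zero_iff_mem.2 (Ideal.subset_span rfl)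
  rw [map_sub, map_sum, map_one, sub_eq_zero] at this
  exact this

/-- The homomorphism sending `tⱼ` to the sum of all `tᵢ` with `θ i = j`. -/
def simplexRing.map {p q : ℕ} (θ : Fin (p + 1) → Fin (q + 1)) : simplexRing k q →ₐ[k] simplexRing k p :=
  Ideal.Quotient.liftₐ _ (MvPolynomial.aeval fun j => ∑ i with θ i = j, simplexRing.t k i) <| by
    intro a ha
    rw [← RingHom.mem_ker]
    refine (Ideal.span_le.2 ?_) ha
    rintro _ rfl
    simp only [SetLike.mem_coe, RingHom.mem_ker, map_sub, map_sum, map_one, MvPolynomial.aeval_X]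
    rw [Finset.sum_fiberwise, simplexRing.sum_t, sub_self]

@[simp] lemma simplexRing.map_t {p q : ℕ} (θ : Fin (p + 1) → Fin (q + 1)) (j : Fin (q + 1)) :
    simplexRing.map k θ (simplexRing.t k j) = ∑ i with θ i = j, simplexRing.t k i := by
  refine (Ideal.Quotient.lift_mk _ _ _).trans ?_
  exact MvPolynomial.aeval_X _ _

lemma simplexRing.hom_ext {p : ℕ} {A : Type*} [CommRing A] [Algebra k A] {f g : simplexRing k p →ₐ[k] A}
    (h : ∀ i, f (simplexRing.t k i) = g (simplexRing.t k i)) : f = g :=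
  Ideal.Quotient.algHom_ext _ (MvPolynomial.algHom_ext h)

lemma simplexRing.map_id (p : ℕ) : simplexRing.map k (id : Fin (p + 1) → _) = AlgHom.id _ _ := by
  refine simplexRing.hom_ext k fun i => ?_
  simp [Finset.filter_eq']

lemma simplexRing.map_comp {p q r : ℕ} (θ : Fin (p + 1) → Fin (q + 1)) (η : Fin (q + 1) → Fin (r + 1)) :
    simplexRing.map k (η ∘ θ) = (simplexRing.map k θ).comp (simplexRing.map k η) := by
  refine simplexRing.hom_ext k fun i => ?_
  simp only [simplexRing.map_t, AlgHom.comp_apply, map_sum, Function.comp_apply]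
  rw [← Finset.sum_fiberwise_of_maps_to (s := Finset.univ.filter fun x => η (θ x) = i)
    (t := Finset.univ.filter fun y => η y = i) (g := θ) (by simp)]
  refine Finset.sum_congr rfl fun y hy => Finset.sum_congr ?_ fun _ _ => rfl
  ext x
  simp only [Finset.mem_filter, Finset.mem_univ, true_and] at hy ⊢
  exact ⟨fun h => h.2, fun h => ⟨by rw [h, hy], h⟩⟩

/-- The base field as a scheme. -/
abbrev base : Scheme.{u} := Spec (.of k)

/-- The morphism of spectra given by a map of vertices. -/
def simplexSpecMap {p q : ℕ} (θ : Fin (p + 1) → Fin (q + 1)) :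
    Spec (.of (simplexRing k p)) ⟶ Spec (.of (simplexRing k q)) :=
  Spec.map (CommRingCat.ofHom (simplexRing.map k θ : simplexRing k q →+* simplexRing k p))

/-- The algebraic simplex `Δᵖ = Spec k[t₀, …, tₚ]/(t₀ + ⋯ + tₚ - 1)`. -/
def simplexObj (p : ℕ) : Over (base k) :=
  Over.mk (Spec.map (CommRingCat.ofHom (algebraMap k (simplexRing k p))))

/-- The morphism of algebraic simplices given by a map of vertices. -/
def simplexMap {p q : ℕ} (θ : Fin (p + 1) → Fin (q + 1)) : simplexObj k p ⟶ simplexObj k q :=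
  Over.homMk (simplexSpecMap k θ) ((Spec.map_comp _ _).symm.trans
    (congr_arg Spec.map (CommRingCat.hom_ext (AlgHom.comp_algebraMap (simplexRing.map k θ)))))

lemma simplexMap_id (p : ℕ) : simplexMap k (id : Fin (p + 1) → _) = 𝟙 (simplexObj k p) := by
  refine Over.OverMorphism.ext (Eq.trans ?_ (Spec.map_id _))
  exact congr_arg (fun f : simplexRing k p →ₐ[k] simplexRing k p =>
    Spec.map (CommRingCat.ofHom (f : simplexRing k p →+* simplexRing k p))) (simplexRing.map_id k p)

lemma simplexMap_comp {p q r : ℕ} (θ : Fin (p + 1) → Fin (q + 1))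
    (η : Fin (q + 1) → Fin (r + 1)) :
    simplexMap k (η ∘ θ) = simplexMap k θ ≫ simplexMap k η := by
  refine Over.OverMorphism.ext (Eq.trans ?_ (Spec.map_comp _ _))
  exact congr_arg (fun f : simplexRing k r →ₐ[k] simplexRing k p =>
    Spec.map (CommRingCat.ofHom (f : simplexRing k r →+* simplexRing k p)))
    (simplexRing.map_comp k θ η)

/-- The standard cosimplicial scheme of algebraic simplices over `k`. -/
def simplex : SimplexCategory ⥤ Over (base k) where
  obj p := simplexObj k p.len
  map θ := simplexMap k θ.toOrderHom
  map_id p := simplexMap_id k p.len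
  map_comp θ η := simplexMap_comp k θ.toOrderHom η.toOrderHom

/-- The point `Spec k`. -/
abbrev pt : Over (base k) := Over.mk (𝟙 _)

variable {k}

/-- The simplicial abelian group `ℤF(Δ^•, Y)`. -/
def simplicialZF (Y : Over (base k)) : SimplicialObject AddCommGrpCat.{u + 1} :=
  (simplex k).op ⋙ ZF.functor Y

/-- The complex `C_* ℤF(pt, Y)`. -/
def complexZF (Y : Over (base k)) : ChainComplex AddCommGrpCat.{u + 1} ℕ :=
  (AlgebraicTopology.alternatingFaceMapComplex _).obj (simplicialZF Y)

/-- The group `H^0(C_* ℤF(pt, Y))`. -/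
abbrev H0 (Y : Over (base k)) : AddCommGrpCat.{u + 1} := (complexZF Y).homology 0

/-- The projection from the degree zero term (all of whose elements are cycles) to `H^0`. -/
def toH0 (Y : Over (base k)) : ZF ((simplex k).obj (.mk 0)) Y →+ H0 Y :=
  ((complexZF Y).pOpcycles 0 ≫ (complexZF Y).isoHomologyι₀.inv).hom

/-- The isomorphism from the zero-dimensional simplex to the point. -/
def simplexToPt : (simplex k).obj (.mk 0) ⟶ pt k := Over.homMk (((simplex k).obj (.mk 0)).hom)

/-- The class of an explicit correspondence from the point to `Y` in `H^0(C_* ℤF(pt, Y))`. -/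
def h0Class {n N : ℕ} {Y : Over (base k)} (c : ExplicitCob n N (pt k) Y) : H0 Y :=
  toH0 Y (ZF.pull simplexToPt (ZF.cls c))

end Simplex

namespace ExplicitCob

variable {S : Scheme.{u}} {n N : ℕ} {X Y : Over S}

/-- The embedding of `Z` into its étale neighbourhood `W`. -/
def zToW (c : ExplicitCob n N X Y) : redSub c.Z ⟶ c.W :=
  haveI := c.nbhd.isIso
  inv (pullback.snd c.e (redι c.Z)) ≫ pullback.fst c.e (redι c.Z)

lemma zToW_e (c : ExplicitCob n N X Y) : c.zToW ≫ c.e = redι c.Z := by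
  have := c.nbhd.isIso
  rw [zToW, Category.assoc, pullback.condition, IsIso.inv_hom_id_assoc]

/-- The morphism `g|_Z : X ≅ Z ⟶ Y`, for a correspondence whose support projects isomorphically
to `X`. -/
def restrictToSupport (c : ExplicitCob n N X Y) [IsIso (redι c.Z ≫ affProj n X.left)] : X ⟶ Y :=
  Over.homMk (inv (redι c.Z ≫ affProj n X.left) ≫ c.zToW ≫ c.g) (by
    have h := c.zToW_e
    rw [Category.assoc, Category.assoc, c.g_over, reassoc_of% h, IsIso.inv_comp_eq, Category.assoc])

end ExplicitCob

/-- `φ : W ⟶ τ_{n,N}` meets the zero section transversally at `x`: in a local trivialisation of `E`,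
the components of the section `s` vanish at `x` and have linearly independent differentials there. -/
def TautMap.IsTransverseAt {W : Scheme.{u}} {n N : ℕ} (φ : TautMap W n N) (x : W) : Prop :=
  ∀ (i : φ.ι) (hx : x ∈ (φ.chart i).U),
    ∃ h : ∀ p, W.presheaf.germ _ x hx ((φ.chart i).v p) ∈
        IsLocalRing.maximalIdeal (W.presheaf.stalk x),
      LinearIndependent (IsLocalRing.ResidueField (W.presheaf.stalk x)) fun p =>
        (IsLocalRing.maximalIdeal (W.presheaf.stalk x)).toCotangent ⟨_, h p⟩

/-- `Z` is cut out transversally by the zero section. -/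
def ExplicitCob.IsTransverse {S : Scheme.{u}} {n N : ℕ} {X Y : Over S}
    (c : ExplicitCob n N X Y) : Prop :=
  ∀ x ∈ c.φ.zeroLocus, c.φ.IsTransverseAt x

end CobFramed

end

open CobFramed

/-! Transversality says that in a trivialisation of E near the point z of Z the components of the
section have independent differentials at z. Since W is an étale neighbourhood of a rational point,
the centred coordinates x - z generate the maximal ideal there, so the section is M(x - z) with M
invertible near z. The bundle E is only a quotient of 𝒪^N, with no preferred trivialisation, so M
can be absorbed: changing the trivialisation by M⁻¹ turns the section into x - z and the epimorphism
A into M⁻¹A. No path from M to the identity is needed. After shrinking W the correspondence is thus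
given by a right invertible matrix and the section x - z (`exists_isUnit_mulVec_eq`,
`maximalIdeal_le_span_of_factor`, `exists_single`).

A single homotopy over Δ¹, with parameter t, then carries out three deformations at once
(`homotopy`). The ambient affine space is translated by -tz, which carries the support to the
origin. The map g follows the straight line in affine space to the constant g(z), on the open set
where this line stays in Y; on the support the line is constant, so this open set is still a
neighbourhood of it. The matrix, after n zero columns are added, is joined to a constant matrix B by
`matrixPath`, which is right invertible for every t. The section x - z itself is not deformed, so
the zero locus in the product of W with Δ¹ does not move.

At t = 0 this gives back the correspondence (`homotopy_zero`). At t = 1 it gives the class of (𝔸ⁿ,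
(B, x), constant map g(z)) (`homotopy_one`), which for B = (1 | 0) is a stabilisation of the level-0
correspondence (`exists_isStandard_square`, `IsStandard.exists_colBlock`). The two ends have the
same class in H⁰ by `toH0_pull_δ`. -/

noncomputable section

namespace CobFramed

/-! ### Isomorphism of quotients with section; globally trivialised maps to τ. -/

namespace LocalQuot

variable {W : Scheme.{u}} {n N : ℕ}

lemma Agree.symm {a b : LocalQuot W n N} (h : a.Agree b) : b.Agree a := by
  obtain ⟨g, hg, hA, hv⟩ := h
  obtain ⟨⟨g, g', h1, h2⟩, rfl⟩ := hg
  have key {x : Fin n → Γ(W, a.U ⊓ b.U)} {y : Fin n → Γ(W, a.U ⊓ b.U)}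
      (h : ∀ p, y p = ∑ r, g p r * x r) (p) : x p = ∑ r, g' p r * y r := by
    have : y = g.mulVec x := funext h
    have h3 : g'.mulVec y = x := by rw [this, Matrix.mulVec_mulVec, h2, Matrix.one_mulVec]
    exact (congr_fun h3 p).symm
  have le : b.U ⊓ a.U ≤ a.U ⊓ b.U := le_of_eq (inf_comm _ _)
  refine ⟨g'.map (res le), ?_, fun p q => ?_, fun p => ?_⟩
  · exact (Units.isUnit ⟨g', g, h2, h1⟩).map (res le).mapMatrix
  · have := congr_arg (res le) (key (fun p => hA p q) p)
    rw [map_sum] at this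
    simpa [res_res] using this
  · have := congr_arg (res le) (key hv p)
    rw [map_sum] at this
    simpa [res_res] using this

/-- The transition matrix is the product through `b`, which exists only where all three pieces are
defined; `hU` makes this the whole of `a.U ⊓ c.U`. -/
lemma Agree.trans {a b c : LocalQuot W n N} (h : a.Agree b) (h' : b.Agree c)
    (hU : a.U ⊓ c.U ≤ b.U) : a.Agree c := by
  obtain ⟨g, hg, hA, hv⟩ := h
  obtain ⟨g', hg', hA', hv'⟩ := h'
  have l₁ : a.U ⊓ c.U ≤ a.U ⊓ b.U := le_inf inf_le_left hU
  have l₂ : a.U ⊓ c.U ≤ b.U ⊓ c.U := le_inf hU inf_le_right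
  have key {x : Fin n → Γ(W, a.U)} {y : Fin n → Γ(W, b.U)}
      {z : Fin n → Γ(W, c.U)}
      (h : ∀ p, res (inf_le_right : a.U ⊓ b.U ≤ b.U) (y p) =
        ∑ r, g p r * res (inf_le_left : a.U ⊓ b.U ≤ a.U) (x r))
      (h' : ∀ p, res (inf_le_right : b.U ⊓ c.U ≤ c.U) (z p) =
        ∑ r, g' p r * res (inf_le_left : b.U ⊓ c.U ≤ b.U) (y r)) (p) :
      res (inf_le_right : a.U ⊓ c.U ≤ c.U) (z p) = ∑ r, (g'.map (res l₂) * g.map (res l₁)) p r *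
        res (inf_le_left : a.U ⊓ c.U ≤ a.U) (x r) := by
    have e₂ := congr_arg (res l₂) (h' p)
    have e₁ := fun s => congr_arg (res l₁) (h s)
    simp only [map_sum, map_mul, res_res] at e₁ e₂
    rw [e₂]
    simp only [e₁, Matrix.mul_apply, Matrix.map_apply, Finset.mul_sum, Finset.sum_mul]
    rw [Finset.sum_comm]
    simp only [mul_assoc]
  exact ⟨_, (hg'.map (res l₂).mapMatrix).mul (hg.map (res l₁).mapMatrix),
    fun p q => key (fun p => hA p q) (fun p => hA' p q) p,
    fun p => key hv hv' p⟩

end LocalQuot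

namespace TautMap

variable {W W' : Scheme.{u}} {n N : ℕ}

/-- The morphism to `τ_{n,N}` given by a globally trivialised quotient with section. -/
def single (A : Matrix (Fin n) (Fin N) Γ(W, ⊤)) (v : Fin n → Γ(W, ⊤))
    (hA : ∃ B : Matrix (Fin N) (Fin n) Γ(W, ⊤), A * B = 1) : TautMap W n N where
  ι := PUnit
  chart _ := ⟨⊤, A, v, hA⟩
  cover _ := ⟨⟨⟩, trivial⟩
  compat _ _ := .refl _

lemma exists_rightInverse_map {R S : Type*} [CommRing R] [CommRing S] (f : R →+* S)
    {A : Matrix (Fin n) (Fin N) R} (hA : ∃ B : Matrix (Fin N) (Fin n) R, A * B = 1) :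
    ∃ B : Matrix (Fin N) (Fin n) S, A.map f * B = 1 := by
  obtain ⟨B, hB⟩ := hA
  exact ⟨B.map f, by rw [← Matrix.map_mul, hB, Matrix.map_one _ (map_zero _) (map_one _)]⟩

lemma pull_single (f : W' ⟶ W) (A : Matrix (Fin n) (Fin N) Γ(W, ⊤)) (v : Fin n → Γ(W, ⊤))
    (hA : ∃ B : Matrix (Fin N) (Fin n) Γ(W, ⊤), A * B = 1) :
    (single A v hA).pull f = single (A.map f.appTop.hom) (fun p => f.appTop (v p))
      (exists_rightInverse_map f.appTop.hom hA) := rfl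

lemma single_congr {A A' : Matrix (Fin n) (Fin N) Γ(W, ⊤)} {v v' : Fin n → Γ(W, ⊤)}
    (hA : ∃ B : Matrix (Fin N) (Fin n) Γ(W, ⊤), A * B = 1) (h : A = A') (h' : v = v') :
    single A v hA = single A' v' (h ▸ hA) := by
  subst h h'; rfl

lemma stabLast_single (A : Matrix (Fin n) (Fin N) Γ(W, ⊤)) (v : Fin n → Γ(W, ⊤))
    (hA : ∃ B : Matrix (Fin N) (Fin n) Γ(W, ⊤), A * B = 1) :
    (single A v hA).stabLast = single (padZero A) v (padZero_epi hA) := rfl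

lemma res_top (t : Γ(W, ⊤)) : res (le_top : (⊤ : W.Opens) ≤ ⊤) t = t := by
  simp [res]

lemma stabFirst_single (t : Γ(W, ⊤)) (A : Matrix (Fin n) (Fin N) Γ(W, ⊤)) (v : Fin n → Γ(W, ⊤))
    (hA : ∃ B : Matrix (Fin N) (Fin n) Γ(W, ⊤), A * B = 1) :
    (single A v hA).stabFirst t = single (blockOne A) (Fin.cons t v)
      ((LocalQuot.stabFirst t ⟨⊤, A, v, hA⟩).epi) := by
  have : (single A v hA).stabFirst t = single (blockOne A) (Fin.cons (res le_top t) v)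
      ((LocalQuot.stabFirst t ⟨⊤, A, v, hA⟩).epi) := rfl
  rw [this]
  exact single_congr _ rfl (by rw [res_top])

lemma zeroLocus_single (A : Matrix (Fin n) (Fin N) Γ(W, ⊤)) (v : Fin n → Γ(W, ⊤))
    (hA : ∃ B : Matrix (Fin N) (Fin n) Γ(W, ⊤), A * B = 1) :
    (single A v hA).zeroLocus = {x | ∀ p, x ∉ W.basicOpen (v p)} := by
  ext x
  exact ⟨fun h p => h ⟨⟩ p, fun h _ p => h p⟩

/-- The transition matrix writes each component of one section as a combination of the components of
the other, so membership in the maximal ideal of the stalk is inherited. -/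
lemma Same.zeroLocus_subset {φ ψ : TautMap W n N} (h : φ.Same ψ) :
    φ.zeroLocus ⊆ ψ.zeroLocus := by
  intro x hx j p hp
  obtain ⟨i, hi⟩ := φ.cover x
  obtain ⟨g, -, -, hv⟩ := h i j
  have hj : x ∈ (ψ.chart j).U := W.basicOpen_le _ hp
  have hm : x ∈ (φ.chart i).U ⊓ (ψ.chart j).U := ⟨hi, hj⟩
  rw [Scheme.mem_basicOpen _ _ _ hj] at hp
  have h1 := congr_arg (W.presheaf.germ _ x hm) (hv p)
  rw [map_sum] at h1
  have h2 : ∀ r, W.presheaf.germ _ x hi ((φ.chart i).v r) ∈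
      IsLocalRing.maximalIdeal (W.presheaf.stalk x) := fun r => by
    rw [IsLocalRing.mem_maximalIdeal, mem_nonunits_iff, ← Scheme.mem_basicOpen]
    exact hx i r
  have h3 : W.presheaf.germ _ x hj ((ψ.chart j).v p) ∈
      IsLocalRing.maximalIdeal (W.presheaf.stalk x) := by
    have e : W.presheaf.germ _ x hm (res inf_le_right ((ψ.chart j).v p)) =
      W.presheaf.germ _ x hj ((ψ.chart j).v p) := TopCat.Presheaf.germ_res_apply _ _ _ _ _
    rw [← e, h1]
    refine Ideal.sum_mem _ fun r _ => ?_
    rw [map_mul]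
    refine Ideal.mul_mem_left _ _ ?_
    have e' : W.presheaf.germ _ x hm (res inf_le_left ((φ.chart i).v r)) =
      W.presheaf.germ _ x hi ((φ.chart i).v r) := TopCat.Presheaf.germ_res_apply _ _ _ _ _
    rw [e']
    exact h2 r
  exact h3 hp

lemma Same.symm {φ ψ : TautMap W n N} (h : φ.Same ψ) : ψ.Same φ := fun i j => (h j i).symm

lemma Same.zeroLocus_eq {φ ψ : TautMap W n N} (h : φ.Same ψ) : φ.zeroLocus = ψ.zeroLocus :=
  h.zeroLocus_subset.antisymm h.symm.zeroLocus_subset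

end TautMap

/-! ### Shrinking neighbourhoods, translations, and comparison of pull-backs. -/

lemma IsEtaleNhd.comp_openImmersion {W W' A : Scheme.{u}} {e : W ⟶ A} {Z : Closeds A}
    (h : IsEtaleNhd e Z) (i : W' ⟶ W) [IsOpenImmersion i] (hi : e ⁻¹' Z ⊆ Set.range i) :
    IsEtaleNhd (i ≫ e) Z := by
  obtain ⟨h1, h2⟩ := h
  refine ⟨inferInstance, ?_⟩
  let d : pullback (i ≫ e) (redι Z) ⟶ pullback e (redι Z) :=
    pullback.lift (pullback.fst (i ≫ e) (redι Z) ≫ i) (pullback.snd (i ≫ e) (redι Z))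
      (by rw [Category.assoc, pullback.condition])
  have hd1 : d ≫ pullback.fst e (redι Z) = pullback.fst (i ≫ e) (redι Z) ≫ i :=
    pullback.lift_fst _ _ _
  have hd2 : d ≫ pullback.snd e (redι Z) = pullback.snd (i ≫ e) (redι Z) :=
    pullback.lift_snd _ _ _
  have sq : IsPullback (pullback.fst (i ≫ e) (redι Z)) d i (pullback.fst e (redι Z)) := by
    refine (IsPullback.of_right (h₁₂ := pullback.snd e (redι Z)) (h₂₂ := e) (v₁₃ := redι Z)
      ?_ hd1 (IsPullback.of_hasPullback e (redι Z)).flip).flip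
    rw [hd2]
    exact (IsPullback.of_hasPullback (i ≫ e) (redι Z)).flip
  have hd : IsOpenImmersion d := MorphismProperty.of_isPullback (P := @IsOpenImmersion) sq inferInstance
  -- The base change of `i` to Z is an open immersion; it is onto because `i` already covers the
  -- preimage of Z, hence it is an isomorphism.
  have hs : Function.Surjective d := by
    rw [← Set.range_eq_univ]
    have := Scheme.image_preimage_eq_of_isPullback sq Set.univ
    simp only [Set.preimage_univ, Set.image_univ] at this
    rw [this, Set.eq_univ_iff_forall]
    intro x
    apply hi
    have h3 : e (pullback.fst e (redι Z) x) = redι Z (pullback.snd e (redι Z) x) := by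
      rw [← Scheme.Hom.comp_apply, ← Scheme.Hom.comp_apply, pullback.condition]
    change e (pullback.fst e (redι Z) x) ∈ (Z : Set A)
    rw [h3, ← range_redι]
    exact ⟨_, rfl⟩
  have : Epi d.base := (TopCat.epi_iff_surjective _).2 hs
  have : IsIso d := IsOpenImmersion.isIso d
  rw [← hd2]
  infer_instance

/-- The automorphism `x ↦ x + a` of affine space. -/
def translation {n : ℕ} {X : Scheme.{u}} (a : Fin n → Γ(X, ⊤)) : Aff n X ⟶ Aff n X :=
  AffineSpace.homOfVector (affProj n X)
    (fun i => AffineSpace.coord X i + (affProj n X).appTop (a i.down))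

section translation

variable {n : ℕ} {X : Scheme.{u}} (a b : Fin n → Γ(X, ⊤))

lemma translation_proj : translation a ≫ affProj n X = affProj n X :=
  AffineSpace.homOfVector_over _ _

lemma translation_coord (i : Fin n) : (translation a).appTop (AffineSpace.coord X ⟨i⟩) =
    AffineSpace.coord X ⟨i⟩ + (affProj n X).appTop (a i) :=
  AffineSpace.homOfVector_appTop_coord _ _ _

lemma translation_comp : translation a ≫ translation b = translation (a + b) := by
  refine AffineSpace.hom_ext ?_ fun i => ?_
  · simp only [Category.assoc, translation_proj]
  · obtain ⟨i⟩ := i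
    have h : (translation a).appTop ((affProj n X).appTop (b i)) = (affProj n X).appTop (b i) := by
      rw [← CommRingCat.comp_apply, ← Scheme.Hom.comp_appTop, translation_proj]
    rw [Scheme.Hom.comp_appTop, CommRingCat.comp_apply, translation_coord, translation_coord,
      map_add, translation_coord, h, Pi.add_apply, map_add, add_assoc]

lemma translation_zero : translation (0 : Fin n → Γ(X, ⊤)) = 𝟙 _ := by
  refine AffineSpace.hom_ext ?_ fun i => ?_
  · rw [translation_proj, Category.id_comp]
  · obtain ⟨i⟩ := i
    rw [translation_coord]
    simp

instance : IsIso (translation a) :=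
  ⟨translation (-a), by rw [translation_comp, add_neg_cancel, translation_zero],
    by rw [translation_comp, neg_add_cancel, translation_zero]⟩

end translation

namespace ExplicitCob

variable {S : Scheme.{u}} {n N N' : ℕ} {X X' X'' Y : Over S}

/-- The correspondence with the same support on a smaller étale neighbourhood, with new maps to
`τ` and `Y`. -/
def replace (c : ExplicitCob n N X Y) {W' : Scheme.{u}} (i : W' ⟶ c.W) [IsOpenImmersion i]
    (hi : c.e ⁻¹' c.Z ⊆ Set.range i) (φ' : TautMap W' n N') (hφ : φ'.zeroLocus = (i ≫ c.e) ⁻¹' c.Z)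
    (g' : W' ⟶ Y.left) (hg : g' ≫ Y.hom = (i ≫ c.e) ≫ affProj n X.left ≫ X.hom) :
    ExplicitCob n N' X Y where
  Z := c.Z
  finite := c.finite
  W := W'
  e := i ≫ c.e
  nbhd := c.nbhd.comp_openImmersion i hi
  φ := φ'
  zero := hφ
  g := g'
  g_over := hg

lemma replace_equivalent (c : ExplicitCob n N X Y) {W' : Scheme.{u}} (i : W' ⟶ c.W)
    [IsOpenImmersion i] (hi : c.e ⁻¹' c.Z ⊆ Set.range i) (φ' : TautMap W' n N)
    (hφ : φ'.zeroLocus = (i ≫ c.e) ⁻¹' c.Z) (h : φ'.Same (c.φ.pull i))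
    (hg : (i ≫ c.g) ≫ Y.hom = (i ≫ c.e) ≫ affProj n X.left ≫ X.hom) :
    (c.replace i hi φ' hφ (i ≫ c.g) hg).Equivalent c :=
  .of_hom rfl i rfl h rfl

/-- The correspondence obtained by a translation of the ambient affine space. -/
def translate (a : Fin n → Γ(X.left, ⊤)) (c : ExplicitCob n N X Y) : ExplicitCob n N X Y where
  Z := c.Z.preimage (translation (-a)).continuous
  finite := by
    obtain ⟨l, hl, hl'⟩ := exists_lift_of_subset_range
      (c.Z.preimage (translation (-a)).continuous) (redι c.Z ≫ translation a) (by
        intro x hx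
        have hx' : translation (-a) x ∈ (c.Z : Set _) := hx
        rw [← range_redι] at hx'
        obtain ⟨y, hy⟩ := hx'
        refine ⟨y, ?_⟩
        rw [Scheme.Hom.comp_apply, hy, ← Scheme.Hom.comp_apply, translation_comp, neg_add_cancel,
          translation_zero]
        rfl)
    rw [← hl, Category.assoc, Category.assoc, translation_proj]
    have := c.finite
    infer_instance
  W := c.W
  e := c.e ≫ translation a
  nbhd := by
    have h := c.nbhd.baseChange (translation (-a)) (c.Z.preimage (translation (-a)).continuous)
      fun _ h => h
    -- Translations are invertible, so W itself is the base change of `c.e` along the inverse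
    -- translation, and the neighbourhood property is transported along this isomorphism.
    let l : c.W ⟶ pullback c.e (translation (-a)) := pullback.lift (𝟙 _) (c.e ≫ translation a)
      (by rw [Category.assoc, translation_comp, add_neg_cancel, translation_zero]; simp)
    have hl : l ≫ pullback.fst c.e (translation (-a)) = 𝟙 _ := pullback.lift_fst _ _ _
    have : IsIso l := by
      have : IsIso (l ≫ pullback.fst c.e (translation (-a))) := by rw [hl]; infer_instance
      exact IsIso.of_isIso_comp_right l (pullback.fst c.e (translation (-a)))
    have hl2 : l ≫ pullback.snd c.e (translation (-a)) = c.e ≫ translation a :=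
      pullback.lift_snd _ _ _
    rw [← hl2]
    refine h.comp_openImmersion l ?_
    intro x _
    exact ⟨inv l x, by rw [← Scheme.Hom.comp_apply, IsIso.inv_hom_id]; rfl⟩
  φ := c.φ
  zero := by
    rw [c.zero]
    ext x
    change c.e x ∈ c.Z ↔ translation (-a) ((c.e ≫ translation a) x) ∈ c.Z
    rw [← Scheme.Hom.comp_apply, Category.assoc, translation_comp, add_neg_cancel, translation_zero,
      Category.comp_id]
  g := c.g
  g_over := by
    rw [c.g_over, Category.assoc]
    have := translation_proj a
    rw [reassoc_of% this]

/-- Pull-backs of two correspondences are equivalent if their data agree on an étale neighbourhood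
which maps to both. -/
lemma pull_equivalent_pull {X₁ X₂ : Over S} (f₁ : X ⟶ X₁) (f₂ : X ⟶ X₂)
    (c₁ : ExplicitCob n N X₁ Y) (c₂ : ExplicitCob n N X₂ Y)
    (i : (c₁.pull f₁).W ⟶ c₂.W) (hi : i ≫ c₂.e = (c₁.pull f₁).e ≫ affMap n f₂)
    (hZ : pullZ f₁ c₁.Z = pullZ f₂ c₂.Z)
    (hφ : (c₁.pull f₁).φ.Same (c₂.φ.pull i)) (hg : (c₁.pull f₁).g = i ≫ c₂.g) :
    (c₁.pull f₁).Equivalent (c₂.pull f₂) := by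
  refine .of_hom hZ ((c₂.pull_isPullback f₂).lift i _ hi) ?_ ?_ ?_
  · rw [IsPullback.lift_snd]
  · rw [c₂.pull_φ, TautMap.pull_pull, IsPullback.lift_fst]
    exact hφ
  · rw [c₂.pull_g, IsPullback.lift_fst_assoc, hg]

end ExplicitCob

/-! ### Classes in ℤF and homotopy invariance in H⁰. -/

section Classes

variable {S : Scheme.{u}} {n N : ℕ} {X Y : Over S}

lemma ZF.cls_eq_of_equivalent {c c' : ExplicitCob n N X Y} (h : c.Equivalent c') :
    ZF.cls c = ZF.cls c' :=
  congr_arg (fun a => QuotientAddGroup.mk (FreeAbelianGroup.of (StableFr.mk a))) (Quot.sound h)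

lemma ZF.cls_stabLast (c : ExplicitCob n N X Y) : ZF.cls c.stabLast = ZF.cls c :=
  congr_arg (fun a => QuotientAddGroup.mk (FreeAbelianGroup.of a))
    (Quot.sound (StabStep.last (Fr.mk c))).symm

lemma ZF.cls_stabFirst (c : ExplicitCob n N X Y) : ZF.cls c.stabFirst = ZF.cls c :=
  congr_arg (fun a => QuotientAddGroup.mk (FreeAbelianGroup.of a))
    (Quot.sound (StabStep.first (Fr.mk c))).symm

lemma ZF.pull_cls {X' : Over S} (f : X' ⟶ X) (c : ExplicitCob n N X Y) :
    ZF.pull f (ZF.cls c) = ZF.cls (c.pull f) := rfl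

end Classes

section Homotopy

variable {k : Type u} [Field k]

/-- The differential from degree 1 is the difference of the two faces, and boundaries die in H⁰.
Thus the two ends of a homotopy over Δ¹ have the same class. -/
lemma toH0_pull_δ (Y : Over (base k)) (a : ZF ((simplex k).obj (.mk 1)) Y) :
    toH0 Y (ZF.pull ((simplex k).map (SimplexCategory.δ (n := 0) 0)) a) =
      toH0 Y (ZF.pull ((simplex k).map (SimplexCategory.δ (n := 0) 1)) a) := by
  have h : (complexZF Y).d 1 0 ≫ (complexZF Y).pOpcycles 0 = 0 :=
    (complexZF Y).d_pOpcycles 1 0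
  have hd : (complexZF Y).d 1 0 = (simplicialZF Y).δ 0 - (simplicialZF Y).δ 1 := by
    unfold complexZF
    rw [AlgebraicTopology.alternatingFaceMapComplex_obj_d]
    simp [AlgebraicTopology.AlternatingFaceMapComplex.objD, Fin.sum_univ_succ, sub_eq_add_neg]
  have h1 : toH0 Y (((complexZF Y).d 1 0).hom a) = 0 := by
    have h2 := congr_arg (fun f => f ≫ (complexZF Y).isoHomologyι₀.inv) h
    simp only [Category.assoc, zero_comp] at h2
    exact congr($(h2).hom a)
  have h2 : ((complexZF Y).d 1 0).hom a =
      ZF.pull ((simplex k).map (SimplexCategory.δ (n := 0) 0)) a -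
        ZF.pull ((simplex k).map (SimplexCategory.δ (n := 0) 1)) a := congr($(hd).hom a)
  rw [h2] at h1
  exact sub_eq_zero.1 ((map_sub (toH0 Y) _ _).symm.trans h1)

end Homotopy

/-! ### Transversality in a local ring, and spreading out of germs. -/

section LocalAlgebra

/-- As x generates the maximal ideal 𝔪, one can write v = Mx. If det M were in 𝔪, the reduction of M
would have a nonzero left kernel vector a. For a lift b of a, the entries of bM lie in 𝔪, so ∑ bₚvₚ
lies in 𝔪², against the independence of the vₚ in 𝔪/𝔪². -/
lemma exists_isUnit_mulVec_eq {O : Type*} [CommRing O] [IsLocalRing O] {n : ℕ} {x v : Fin n → O}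
    (hx : IsLocalRing.maximalIdeal O ≤ Ideal.span (Set.range x))
    (hx' : ∀ i, x i ∈ IsLocalRing.maximalIdeal O)
    (hv : ∀ p, v p ∈ IsLocalRing.maximalIdeal O)
    (hli : LinearIndependent (IsLocalRing.ResidueField O) fun p =>
      (IsLocalRing.maximalIdeal O).toCotangent ⟨v p, hv p⟩) :
    ∃ M : Matrix (Fin n) (Fin n) O, IsUnit M ∧ ∀ p, v p = ∑ r, M p r * x r := by
  have h (p) : ∃ c : Fin n → O, ∑ r, c r * x r = v p := Ideal.mem_span_range_iff_exists_fun.1 (hx (hv p))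
  choose M hM using h
  refine ⟨Matrix.of M, ?_, fun p => (hM p).symm⟩
  rw [Matrix.isUnit_iff_isUnit_det]
  by_contra hdet
  have hdet' : ((Matrix.of M).map (IsLocalRing.residue O)).det = 0 := by
    rw [← RingHom.mapMatrix_apply, ← RingHom.map_det]
    exact (IsLocalRing.residue_eq_zero_iff _).2 hdet
  obtain ⟨a, ha, haM⟩ := Matrix.exists_vecMul_eq_zero_iff.2 hdet'
  choose b hb using fun p => IsLocalRing.residue_surjective (R := O) (a p)
  refine ha (funext fun p => ?_)
  rw [Fintype.linearIndependent_iff] at hli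
  refine hli a ?_ p
  have hsum : ∑ p, b p * v p ∈ IsLocalRing.maximalIdeal O :=
    Ideal.sum_mem _ fun p _ => Ideal.mul_mem_left _ _ (hv p)
  have e : ∑ p, a p • (IsLocalRing.maximalIdeal O).toCotangent ⟨v p, hv p⟩ =
      (IsLocalRing.maximalIdeal O).toCotangent ⟨∑ p, b p * v p, hsum⟩ := by
    have e1 : (⟨∑ p, b p * v p, hsum⟩ : IsLocalRing.maximalIdeal O) =
      ∑ p, b p • ⟨v p, hv p⟩ := Subtype.ext (by simp)
    rw [e1, map_sum]
    refine Finset.sum_congr rfl fun p _ => ?_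
    rw [map_smul, ← hb p, ← IsLocalRing.ResidueField.algebraMap_eq, algebraMap_smul]
  rw [e, Ideal.toCotangent_eq_zero]
  have e2 : ∑ p, b p * v p = ∑ r, (∑ p, b p * M p r) * x r := by
    simp only [← hM, Finset.mul_sum, Finset.sum_mul, mul_assoc]
    exact Finset.sum_comm
  change ∑ p, b p * v p ∈ _
  rw [e2, pow_two]
  refine Ideal.sum_mem _ fun r _ => Ideal.mul_mem_mul ?_ (hx' r)
  rw [← IsLocalRing.residue_eq_zero_iff, map_sum]
  have := congr_fun haM r
  simpa [Matrix.vecMul, dotProduct, hb] using this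

end LocalAlgebra

section Germs

variable {W : Scheme.{u}}

lemma exists_opens_le {ι : Type*} [Finite ι] {w : W} {U : W.Opens} (hw : w ∈ U) (V : ι → W.Opens)
    (hV : ∀ i, w ∈ V i) : ∃ V' : W.Opens, w ∈ V' ∧ V' ≤ U ∧ ∀ i, V' ≤ V i := by
  have := Fintype.ofFinite ι
  refine ⟨U ⊓ Finset.univ.inf V, ⟨hw, ?_⟩, inf_le_left, fun i =>
    inf_le_right.trans (Finset.inf_le (Finset.mem_univ i))⟩
  simpa [Opens.coe_finset_inf] using hV

lemma exists_germ_eq_of_finite {ι : Type*} [Finite ι] {w : W} {U : W.Opens} (hw : w ∈ U)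
    (f : ι → W.presheaf.stalk w) : ∃ (V : W.Opens) (hV : w ∈ V) (_ : V ≤ U) (s : ι → Γ(W, V)),
      ∀ i, W.presheaf.germ V w hV (s i) = f i := by
  choose V hV s hs using fun i => W.presheaf.exists_germ_eq (f i)
  obtain ⟨V', hw', hU, h⟩ := exists_opens_le hw V hV
  refine ⟨V', hw', hU, fun i => res (h i) (s i), fun i => ?_⟩
  rw [← hs i]
  exact TopCat.Presheaf.germ_res_apply _ _ _ _ _

lemma exists_res_eq_of_finite {ι : Type*} [Finite ι] {w : W} {U : W.Opens} (hw : w ∈ U)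
    {s t : ι → Γ(W, U)} (h : ∀ i, W.presheaf.germ U w hw (s i) = W.presheaf.germ U w hw (t i)) :
    ∃ (V : W.Opens) (_ : w ∈ V) (hVU : V ≤ U), ∀ i, res hVU (s i) = res hVU (t i) := by
  choose V hV i₁ i₂ hs using fun i => W.presheaf.germ_eq w hw hw _ _ (h i)
  obtain ⟨V', hw', hU, h⟩ := exists_opens_le hw V hV
  refine ⟨V', hw', hU, fun i => ?_⟩
  have := congr_arg (res (h i)) (hs i)
  exact ((LocalQuot.res_res (i₁ i).le (h i) (s i)).symm.trans this).trans
    (LocalQuot.res_res (i₂ i).le (h i) (t i))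

end Germs

/-! ### The section of W given by the support, and the centred coordinates. -/

namespace ExplicitCob

variable {S : Scheme.{u}} {n N : ℕ} {X Y : Over S}

/-- This is the universal property of the fibre product of W and Z, which the projection identifies
with Z: over Z there is only one way to lift to W. -/
lemma eq_zToW (c : ExplicitCob n N X Y) {T : Scheme.{u}} (t : T ⟶ c.W) (r : T ⟶ redSub c.Z)
    (h : t ≫ c.e = r ≫ redι c.Z) : t = r ≫ c.zToW := by
  have := c.nbhd.isIso
  have h1 : pullback.lift t r h = r ≫ inv (pullback.snd c.e (redι c.Z)) := by
    rw [IsIso.eq_comp_inv, pullback.lift_snd]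
  rw [zToW, ← reassoc_of% h1, pullback.lift_fst]

lemma range_zToW (c : ExplicitCob n N X Y) : Set.range c.zToW = c.e ⁻¹' c.Z := by
  have := c.nbhd.isIso
  rw [zToW, Scheme.Hom.comp_base, TopCat.coe_comp, Set.range_comp, Set.range_eq_univ.2,
    Set.image_univ, Scheme.Pullback.range_fst, range_redι]
  exact (Scheme.homeoOfIso (asIso (inv (pullback.snd c.e (redι c.Z))))).surjective

variable (c : ExplicitCob n N X Y) [IsIso (redι c.Z ≫ affProj n X.left)]

/-- The section of the étale neighbourhood given by a support which projects isomorphically. -/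
def suppPt : X.left ⟶ c.W := inv (redι c.Z ≫ affProj n X.left) ≫ c.zToW

lemma suppPt_e : c.suppPt ≫ c.e = inv (redι c.Z ≫ affProj n X.left) ≫ redι c.Z := by
  rw [suppPt, Category.assoc, zToW_e]

lemma suppPt_e_proj : c.suppPt ≫ c.e ≫ affProj n X.left = 𝟙 _ := by
  have := c.suppPt_e
  rw [reassoc_of% this, IsIso.inv_hom_id]

lemma suppPt_g : c.suppPt ≫ c.g = c.restrictToSupport.left := by
  rw [suppPt, Category.assoc]; rfl

lemma range_suppPt : Set.range c.suppPt = c.e ⁻¹' c.Z := by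
  rw [← range_zToW, suppPt, Scheme.Hom.comp_base, TopCat.coe_comp, Set.range_comp,
    Set.range_eq_univ.2, Set.image_univ]
  exact (Scheme.homeoOfIso (asIso (inv (redι c.Z ≫ affProj n X.left)))).surjective

/-- The coordinates of the support. -/
def suppCoord (i : Fin n) : Γ(X.left, ⊤) :=
  (c.suppPt ≫ c.e).appTop (AffineSpace.coord X.left ⟨i⟩)

/-- The coordinate functions on the neighbourhood, centred at the support. -/
def centred (i : Fin n) : Γ(c.W, ⊤) :=
  c.e.appTop (AffineSpace.coord X.left ⟨i⟩) - (c.e ≫ affProj n X.left).appTop (c.suppCoord i)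

lemma suppPt_centred (i : Fin n) : c.suppPt.appTop (c.centred i) = 0 := by
  rw [centred, map_sub, ← CommRingCat.comp_apply, ← CommRingCat.comp_apply,
    ← Scheme.Hom.comp_appTop, ← Scheme.Hom.comp_appTop, suppPt_e_proj, suppCoord, sub_eq_zero]
  simp

/-- The centred coordinates cut out the support scheme-theoretically in W. Their vanishing says that
`t ≫ c.e` has the coordinates of the support, hence lands in Z, and over Z the lift to W is unique.
-/
lemma eq_suppPt {T : Scheme.{u}} (t : T ⟶ c.W) (ht : ∀ i, t.appTop (c.centred i) = 0) :
    t = (t ≫ c.e ≫ affProj n X.left) ≫ c.suppPt := by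
  rw [suppPt, ← Category.assoc]
  refine c.eq_zToW t _ ?_
  rw [Category.assoc, ← suppPt_e]
  refine AffineSpace.hom_ext ?_ fun i => ?_
  · have := c.suppPt_e_proj
    simp only [Category.assoc, this, Category.comp_id]
  · obtain ⟨i⟩ := i
    have := ht i
    rw [centred, map_sub, sub_eq_zero, ← CommRingCat.comp_apply, ← CommRingCat.comp_apply,
      ← Scheme.Hom.comp_appTop, ← Scheme.Hom.comp_appTop, suppCoord, ← CommRingCat.comp_apply,
      ← Scheme.Hom.comp_appTop] at this
    exact this

lemma appTop_eq_zero_of_fromSpecResidueField {W : Scheme.{u}} {x : W} {f : Γ(W, ⊤)}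
    (hx : x ∉ W.basicOpen f) : (W.fromSpecResidueField x).appTop f = 0 := by
  rw [← basicOpen_eq_bot_iff]
  refine (Scheme.preimage_basicOpen (W.fromSpecResidueField x) f).symm.trans ?_
  ext y
  have hy : W.fromSpecResidueField x y = x := by
    have : W.fromSpecResidueField x y ∈ Set.range (W.fromSpecResidueField x) := ⟨y, rfl⟩
    rwa [W.range_fromSpecResidueField x] at this
  simp only [Opens.coe_bot, Set.mem_empty_iff_false, iff_false]
  intro h
  have h' : W.fromSpecResidueField x y ∈ W.basicOpen f := h
  rw [hy] at h'
  exact hx h'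

/-- A point is tested on the spectrum of its residue field, where the centred coordinates become
zero and `eq_suppPt` applies. -/
lemma mem_Z_iff_centred (y : c.W) : c.e y ∈ c.Z ↔ ∀ i, y ∉ c.W.basicOpen (c.centred i) := by
  change y ∈ c.e ⁻¹' c.Z ↔ _
  rw [← range_suppPt]
  constructor
  · rintro ⟨x, rfl⟩ i hi
    have h := Scheme.preimage_basicOpen c.suppPt (c.centred i)
    have hx : x ∈ c.suppPt ⁻¹ᵁ c.W.basicOpen (c.centred i) := hi
    rw [h] at hx
    have h0 := c.suppPt_centred i
    change x ∈ X.left.basicOpen (c.suppPt.appTop (c.centred i)) at hx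
    rw [h0, Scheme.basicOpen_zero] at hx
    exact hx
  · intro h
    have := c.eq_suppPt (c.W.fromSpecResidueField y) fun i =>
      appTop_eq_zero_of_fromSpecResidueField (h i)
    obtain ⟨z, hz⟩ : y ∈ Set.range (c.W.fromSpecResidueField y) := by
      rw [c.W.range_fromSpecResidueField y]; rfl
    rw [this] at hz
    exact ⟨_, hz⟩

end ExplicitCob

/-! ### Normal form of a transverse correspondence at a rational point. -/

section PointOverField

variable {k : Type u} [Field k] {n N : ℕ} {Y : Over (base k)}

lemma germ_mem_maximalIdeal {W : Scheme.{u}} {w : W} {f : Γ(W, ⊤)} (h : w ∉ W.basicOpen f) :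
    W.presheaf.germ ⊤ w trivial f ∈ IsLocalRing.maximalIdeal (W.presheaf.stalk w) := by
  rw [IsLocalRing.mem_maximalIdeal, mem_nonunits_iff]
  exact fun hu => h ((Scheme.mem_basicOpen W f w (Opens.mem_top w)).2 hu)

/-- With I the ideal generated by the germs of x, the spectrum of stalk/I maps to W and kills x, so
by `h` it factors through the rational point s. Hence the quotient map of the stalk factors through
evaluation in k, which kills the maximal ideal. The hypothesis `h` is what `eq_suppPt` provides; no
structure theory of étale algebras enters. -/
lemma maximalIdeal_le_span_of_factor {W : Scheme.{u}} (s : base k ⟶ W) (x : Fin n → Γ(W, ⊤))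
    (h : ∀ {T : Scheme.{u}} (t : T ⟶ W), (∀ i, t.appTop (x i) = 0) → ∃ r : T ⟶ base k, t = r ≫ s) :
    IsLocalRing.maximalIdeal (W.presheaf.stalk (s (IsLocalRing.closedPoint k))) ≤
      Ideal.span (Set.range fun i => W.presheaf.germ ⊤ (s (IsLocalRing.closedPoint k)) trivial (x i)) := by
  set w := s (IsLocalRing.closedPoint k)
  set I := Ideal.span (Set.range fun i => W.presheaf.germ ⊤ w trivial (x i)) with hI
  let q : W.presheaf.stalk w ⟶ .of (W.presheaf.stalk w ⧸ I) :=
    CommRingCat.ofHom (Ideal.Quotient.mk I)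
  have h0 (i) : (Spec.map q ≫ W.fromSpecStalk w).appTop (x i) = 0 := by
    have h1 : (Spec.map q ≫ W.fromSpecStalk w).appTop =
        W.presheaf.germ ⊤ w trivial ≫ q ≫ (Scheme.ΓSpecIso _).inv := by
      rw [Scheme.Hom.comp_appTop, Scheme.fromSpecStalk_appTop, Scheme.ΓSpecIso_inv_naturality]
      simp
    rw [h1, CommRingCat.comp_apply, CommRingCat.comp_apply]
    have : q (W.presheaf.germ ⊤ w trivial (x i)) = 0 :=
      Ideal.Quotient.eq_zero_iff_mem.2 (Ideal.subset_span ⟨i, rfl⟩)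
    rw [this, map_zero]
  obtain ⟨r, hr⟩ := h _ h0
  let σ : W.presheaf.stalk w ⟶ .of k := Scheme.stalkClosedPointTo (R := .of k) s
  have hσ : Spec.map σ ≫ W.fromSpecStalk w = s := Scheme.Spec_stalkClosedPointTo_fromSpecStalk s
  -- The map from the spectrum of the stalk to W is a monomorphism, so the factorisation through s
  -- becomes a factorisation of the ring map `q` through `σ`.
  rw [← hσ, ← Category.assoc, cancel_mono, ← Spec.map_preimage r, ← Spec.map_comp] at hr
  have hq := Spec.map_injective hr
  have hloc : IsLocalHom σ.hom := Scheme.isLocalHom_stalkClosedPointTo (R := .of k) s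
  intro f hf
  have hf0 : σ.hom f = 0 := by
    by_contra hne
    exact hf (IsUnit.of_map σ.hom f (isUnit_iff_ne_zero.2 hne))
  refine Ideal.Quotient.eq_zero_iff_mem.1 ?_
  change q.hom f = 0
  rw [hq, CommRingCat.hom_comp, RingHom.comp_apply, hf0, map_zero]

/-- The relation v = Mx and the invertibility of M spread from the stalk to a neighbourhood V inside
one chart. Changing the trivialisation there by L = M⁻¹ replaces (A, v) by (LA, x). -/
lemma exists_single_of_stalk {W : Scheme.{u}} (φ : TautMap W n N) {w : W}
    (x : Fin n → Γ(W, ⊤)) (i : φ.ι) (hw : w ∈ (φ.chart i).U)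
    (M : Matrix (Fin n) (Fin n) (W.presheaf.stalk w)) (hM : IsUnit M)
    (h : ∀ p, W.presheaf.germ _ w hw ((φ.chart i).v p) =
      ∑ r, M p r * W.presheaf.germ ⊤ w trivial (x r)) :
    ∃ (V : W.Opens) (_ : w ∈ V) (A : Matrix (Fin n) (Fin N) Γ(V, ⊤))
      (hA : ∃ B : Matrix (Fin N) (Fin n) Γ(V, ⊤), A * B = 1),
      (φ.pull V.ι).Same (.single A (fun p => V.ι.appTop (x p)) hA) := by
  obtain ⟨V₁, hw₁, le₁, m, hm⟩ := exists_germ_eq_of_finite hw (fun p : Fin n × Fin n => M p.1 p.2)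
  obtain ⟨V₂, hw₂, le₂, h₂⟩ := exists_res_eq_of_finite hw₁
    (s := fun p => res le₁ ((φ.chart i).v p)) (t := fun p => ∑ r, m (p, r) * res le_top (x r)) (by
      intro p
      have e1 : W.presheaf.germ _ w hw₁ (res le₁ ((φ.chart i).v p)) =
        W.presheaf.germ _ w hw ((φ.chart i).v p) := TopCat.Presheaf.germ_res_apply _ _ _ _ _
      have e2 (r) : W.presheaf.germ _ w hw₁ (res le_top (x r)) =
        W.presheaf.germ ⊤ w trivial (x r) := TopCat.Presheaf.germ_res_apply _ _ _ _ _
      rw [e1, h p, map_sum]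
      refine Finset.sum_congr rfl fun r _ => ?_
      rw [map_mul, e2, hm])
  let M₂ : Matrix (Fin n) (Fin n) Γ(W, V₂) := Matrix.of fun p r => res le₂ (m (p, r))
  have hgerm : (W.presheaf.germ V₂ w hw₂).hom.mapMatrix M₂ = M := by
    ext p r
    exact (TopCat.Presheaf.germ_res_apply _ _ _ _ _).trans (hm (p, r))
  -- On this open set M becomes invertible; it contains `w` because M is already invertible in the
  -- stalk.
  let V := W.basicOpen M₂.det
  have hwV : w ∈ V := by
    rw [Scheme.mem_basicOpen _ _ _ hw₂]
    change IsUnit ((W.presheaf.germ V₂ w hw₂).hom M₂.det)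
    rw [RingHom.map_det, hgerm, ← Matrix.isUnit_iff_isUnit_det]
    exact hM
  have le₃ : V ≤ V₂ := W.basicOpen_le _
  have hM₃ : IsUnit ((res le₃).mapMatrix M₂) := by
    rw [Matrix.isUnit_iff_isUnit_det, ← RingHom.map_det]
    exact RingedSpace.isUnit_res_basicOpen _ _
  obtain ⟨⟨M₃, L, hL, hL'⟩, hM₃e⟩ := hM₃
  change M₃ = _ at hM₃e
  have leV : V ≤ (φ.chart i).U := le₃.trans (le₂.trans le₁)
  have hLx (p) : res le_top (x p) = ∑ r, L p r * res leV ((φ.chart i).v r) := by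
    have e (r) : res leV ((φ.chart i).v r) = M₃.mulVec (fun q => res le_top (x q)) r := by
      have := congr_arg (res le₃) (h₂ r)
      simp only [map_sum, map_mul, LocalQuot.res_res] at this
      rw [this]
      refine Finset.sum_congr rfl fun q _ => ?_
      rw [hM₃e]
      simp [M₂, LocalQuot.res_res]
    have e' : L.mulVec (fun r => res leV ((φ.chart i).v r)) = fun q => res le_top (x q) := by
      rw [funext e, Matrix.mulVec_mulVec, hL', Matrix.one_mulVec]
    exact (congr_fun e' p).symm
  have hV : (⊤ : V.toScheme.Opens) ≤ V.ι ⁻¹ᵁ V := fun y _ => y.2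
  -- This identifies functions on the open subset V of W with global functions on V as a scheme.
  let θ : Γ(W, V) →+* Γ(V, ⊤) := (res hV).comp (pullFun V.ι V)
  let A : Matrix (Fin n) (Fin N) Γ(V, ⊤) := (L * (φ.chart i).A.map (res leV)).map θ
  have hA : ∃ B : Matrix (Fin N) (Fin n) Γ(V, ⊤), A * B = 1 := by
    refine TautMap.exists_rightInverse_map θ ?_
    obtain ⟨B, hB⟩ := TautMap.exists_rightInverse_map (res leV) (φ.chart i).epi
    exact ⟨B * M₃, by rw [Matrix.mul_assoc, ← Matrix.mul_assoc _ B, hB, Matrix.one_mul, hL']⟩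
  have hU : (⊤ : V.toScheme.Opens) ≤ V.ι ⁻¹ᵁ (φ.chart i).U := fun y hy => leV y.2
  have hθ {U : W.Opens} (hVU : V ≤ U) (hU : (⊤ : V.toScheme.Opens) ≤ V.ι ⁻¹ᵁ U) (s : Γ(W, U)) :
      θ (res hVU s) = res hU (pullFun V.ι U s) := by
    have := res_pullFun V.ι hVU (fun y (hy : V.ι y ∈ V) => hVU hy) s
    exact (congr_arg (res hV) this.symm).trans (LocalQuot.res_res _ _ _)
  have agree : ((φ.chart i).pull V.ι).Agree ⟨⊤, A, fun p => V.ι.appTop (x p), hA⟩ := by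
    have le : V.ι ⁻¹ᵁ (φ.chart i).U ⊓ ⊤ ≤ ⊤ := le_top
    have le' : V.ι ⁻¹ᵁ (φ.chart i).U ⊓ ⊤ ≤ V.ι ⁻¹ᵁ (φ.chart i).U := inf_le_left
    refine ⟨(L.map θ).map (res le), ?_, fun p q => ?_, fun p => ?_⟩
    · exact ((Units.isUnit ⟨L, M₃, hL', hL⟩).map θ.mapMatrix).map (res le).mapMatrix
    · change res le (θ (∑ r, L p r * res leV ((φ.chart i).A r q))) =
        ∑ r, res le (θ (L p r)) * res le' (pullFun V.ι _ ((φ.chart i).A r q))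
      simp only [map_sum, map_mul, hθ leV hU, LocalQuot.res_res]
    · have e : V.ι.appTop (x p) = θ (res le_top (x p)) := by
        rw [hθ le_top le_top]
        exact (TautMap.res_top _).symm
      change res le (V.ι.appTop (x p)) =
        ∑ r, res le (θ (L p r)) * res le' (pullFun V.ι _ ((φ.chart i).v r))
      rw [e, hLx]
      simp only [map_sum, map_mul, hθ leV hU, LocalQuot.res_res]
  -- Any other chart is compared through chart `i`, which contains all of V.
  exact ⟨V, hwV, A, hA, fun j _ => ((φ.compat j i).pull V.ι).trans agree
    (inf_le_right.trans hU)⟩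

namespace ExplicitCob

/-- A transverse correspondence supported at a rational point is, on a smaller neighbourhood, given
by a globally trivialised quotient together with the section of centred coordinates. -/
lemma exists_single (c : ExplicitCob n N (pt k) Y) [IsIso (redι c.Z ≫ affProj n (pt k).left)]
    (hc : c.IsTransverse) :
    ∃ (V : c.W.Opens) (_ : c.e ⁻¹' c.Z ⊆ V) (A : Matrix (Fin n) (Fin N) Γ(V, ⊤))
      (hA : ∃ B : Matrix (Fin N) (Fin n) Γ(V, ⊤), A * B = 1),
      (c.φ.pull V.ι).Same (.single A (fun p => V.ι.appTop (c.centred p)) hA) := by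
  let s : base k ⟶ c.W := c.suppPt
  -- The spectrum of a field has one point, so a neighbourhood of the single point w contains the
  -- whole preimage of Z.
  have hrange : ∀ y ∈ c.e ⁻¹' c.Z, y = s (IsLocalRing.closedPoint k) := by
    rw [← c.range_suppPt]
    rintro _ ⟨y, rfl⟩
    have : Subsingleton (PrimeSpectrum k) := inferInstance
    exact congr_arg s (this.elim _ _)
  have hw : s (IsLocalRing.closedPoint k) ∈ c.e ⁻¹' c.Z := by
    rw [← c.range_suppPt]; exact ⟨_, rfl⟩
  have hw' : s (IsLocalRing.closedPoint k) ∈ c.φ.zeroLocus := by rw [c.zero]; exact hw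
  obtain ⟨i, hi⟩ := c.φ.cover (s (IsLocalRing.closedPoint k))
  obtain ⟨hv, hli⟩ := hc _ hw' i hi
  obtain ⟨M, hM, h⟩ := exists_isUnit_mulVec_eq
    (maximalIdeal_le_span_of_factor s c.centred fun t ht => ⟨_, c.eq_suppPt t ht⟩)
    (fun i => germ_mem_maximalIdeal ((c.mem_Z_iff_centred _).1 hw i)) hv hli
  obtain ⟨V, hV, A, hA, hs⟩ := exists_single_of_stalk c.φ c.centred i hi M hM h
  exact ⟨V, fun y hy => hrange y hy ▸ hV, A, hA, hs⟩

end ExplicitCob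

end PointOverField

/-! ### Construction of the homotopy. -/

lemma appTop_comp_apply {U V W : Scheme.{u}} (f : U ⟶ V) (g : V ⟶ W) (s : Γ(W, ⊤)) :
    f.appTop (g.appTop s) = (f ≫ g).appTop s := by
  rw [Scheme.Hom.comp_appTop, CommRingCat.comp_apply]

lemma mem_basicOpen_appTop {U V : Scheme.{u}} (f : U ⟶ V) (s : Γ(V, ⊤)) (x : U) :
    x ∈ U.basicOpen (f.appTop s) ↔ f x ∈ V.basicOpen s :=
  (iff_of_eq congr(x ∈ $(Scheme.preimage_basicOpen f s))).symm

namespace ExplicitCob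

section support

variable {S : Scheme.{u}} {n N : ℕ} {X Y : Over S} (c : ExplicitCob n N X Y)
  [IsIso (redι c.Z ≫ affProj n X.left)]

/-- Equivalent correspondences must have equal supports in affine space, so equations for Z are
needed there and not only in W. -/
lemma mem_Z_iff (y : Aff n X.left) : y ∈ c.Z ↔ ∀ i : Fin n, y ∉ (Aff n X.left).basicOpen
    (AffineSpace.coord X.left ⟨i⟩ - (affProj n X.left).appTop (c.suppCoord i)) := by
  have key : (y ∈ c.Z ↔ y ∈ Set.range (c.suppPt ≫ c.e)) := by
    rw [suppPt_e, Scheme.Hom.comp_base, TopCat.coe_comp, Set.range_comp, Set.range_eq_univ.2,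
      Set.image_univ, range_redι]
    · rfl
    · exact (Scheme.homeoOfIso (asIso (inv (redι c.Z ≫ affProj n X.left)))).surjective
  have h0 (i : Fin n) : (c.suppPt ≫ c.e).appTop (AffineSpace.coord X.left ⟨i⟩ -
      (affProj n X.left).appTop (c.suppCoord i)) = 0 := by
    rw [map_sub, appTop_comp_apply, Category.assoc, suppPt_e_proj, suppCoord, sub_eq_zero]
    simp
  rw [key]
  constructor
  · rintro ⟨x, rfl⟩ i hi
    rw [← mem_basicOpen_appTop, h0, Scheme.basicOpen_zero] at hi
    exact hi
  · intro h
    set r := (Aff n X.left).fromSpecResidueField y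
    have : r = (r ≫ affProj n X.left) ≫ c.suppPt ≫ c.e := by
      refine AffineSpace.hom_ext ?_ fun i => ?_
      · simp only [Category.assoc, suppPt_e_proj, Category.comp_id]
      · have := appTop_eq_zero_of_fromSpecResidueField (h i.down)
        rw [map_sub, sub_eq_zero, suppCoord, appTop_comp_apply, appTop_comp_apply] at this
        exact this
    obtain ⟨z, hz⟩ : y ∈ Set.range r := by
      rw [(Aff n X.left).range_fromSpecResidueField y]; rfl
    rw [this] at hz
    exact ⟨_, hz⟩

end support

section reframe

variable {S : Scheme.{u}} {n N N' : ℕ} {X Y : Over S}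

/-- The correspondence with the same neighbourhood and another map to `τ`. -/
def reframe (c : ExplicitCob n N X Y) (φ' : TautMap c.W n N')
    (h : φ'.zeroLocus = c.φ.zeroLocus) : ExplicitCob n N' X Y where
  __ := c
  φ := φ'
  zero := h.trans c.zero

end reframe

section homotopy

variable {S : Scheme.{u}} {n N N' m : ℕ} {X Y I : Over S} (c : ExplicitCob n N X Y)
  [IsIso (redι c.Z ≫ affProj n X.left)] (π : I ⟶ X) (T : Γ(I.left, ⊤))
  (j : Y.left ⟶ Aff m S)

/-- The projection of the product of the neighbourhood with `I` to `I`. -/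
def cylProj : (c.pull π).W ⟶ I.left := (c.pull π).e ≫ affProj n I.left

omit [IsIso (redι c.Z ≫ affProj n X.left)] in
lemma pullFst_e_proj : c.pullFst π ≫ c.e ≫ affProj n X.left = c.cylProj π ≫ π.left := by
  rw [(c.pull_isPullback π).w_assoc, cylProj, Category.assoc]
  congr 1
  exact AffineSpace.map_over _

/-- The straight line homotopy from `g` to the constant map with value at the support. -/
def lineMap : (c.pull π).W ⟶ Aff m S :=
  AffineSpace.homOfVector (c.cylProj π ≫ I.hom) fun l =>
    (1 - (c.cylProj π).appTop T) * (c.pullFst π ≫ c.g ≫ j).appTop (AffineSpace.coord S l) +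
      (c.cylProj π).appTop T *
        (c.cylProj π ≫ π.left ≫ c.suppPt ≫ c.g ≫ j).appTop (AffineSpace.coord S l)

lemma lineMap_proj : c.lineMap π T j ≫ affProj m S = c.cylProj π ≫ I.hom :=
  AffineSpace.homOfVector_over _ _

lemma comp_lineMap_coord {Q : Scheme.{u}} (q : Q ⟶ (c.pull π).W) (l : ULift.{u} (Fin m)) :
    (q ≫ c.lineMap π T j).appTop (AffineSpace.coord S l) =
      (1 - (q ≫ c.cylProj π).appTop T) *
        (q ≫ c.pullFst π ≫ c.g ≫ j).appTop (AffineSpace.coord S l) +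
      (q ≫ c.cylProj π).appTop T *
        (q ≫ c.cylProj π ≫ π.left ≫ c.suppPt ≫ c.g ≫ j).appTop (AffineSpace.coord S l) := by
  have h : (c.lineMap π T j).appTop (AffineSpace.coord S l) = _ :=
    AffineSpace.homOfVector_appTop_coord _ _ _
  rw [← appTop_comp_apply, h]
  simp only [map_add, map_mul, map_sub, map_one, appTop_comp_apply]

variable (hj : j ≫ affProj m S = Y.hom)

include hj in
omit [IsIso (redι c.Z ≫ affProj n X.left)] in
lemma g_j_proj : c.g ≫ j ≫ affProj m S = c.e ≫ affProj n X.left ≫ X.hom := by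
  rw [hj, c.g_over]

include hj in
lemma comp_lineMap_of_zero {Q : Scheme.{u}} (q : Q ⟶ (c.pull π).W)
    (h : (q ≫ c.cylProj π).appTop T = 0) :
    q ≫ c.lineMap π T j = q ≫ c.pullFst π ≫ c.g ≫ j := by
  refine AffineSpace.hom_ext ?_ fun l => ?_
  · have := c.pullFst_e_proj π
    simp only [Category.assoc, lineMap_proj, c.g_j_proj j hj, reassoc_of% this, Over.w]
  · rw [comp_lineMap_coord, h]
    ring

include hj in
lemma comp_lineMap_of_one {Q : Scheme.{u}} (q : Q ⟶ (c.pull π).W)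
    (h : (q ≫ c.cylProj π).appTop T = 1) :
    q ≫ c.lineMap π T j = q ≫ c.cylProj π ≫ π.left ≫ c.suppPt ≫ c.g ≫ j := by
  refine AffineSpace.hom_ext ?_ fun l => ?_
  · have := c.suppPt_e_proj
    simp only [Category.assoc, lineMap_proj, c.g_j_proj j hj, reassoc_of% this, Over.w]
  · rw [comp_lineMap_coord, h]
    ring

include hj in
-- Where a point of W coincides with the support, the two ends of the line are equal, and (1 - T)g +
-- Tg = g.
lemma comp_lineMap_of_supp {Q : Scheme.{u}} (q : Q ⟶ (c.pull π).W)
    (h : q ≫ c.pullFst π = q ≫ c.cylProj π ≫ π.left ≫ c.suppPt) :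
    q ≫ c.lineMap π T j = q ≫ c.pullFst π ≫ c.g ≫ j := by
  refine AffineSpace.hom_ext ?_ fun l => ?_
  · have := c.pullFst_e_proj π
    simp only [Category.assoc, lineMap_proj, c.g_j_proj j hj, reassoc_of% this, Over.w]
  · have h2 : q ≫ c.cylProj π ≫ π.left ≫ c.suppPt ≫ c.g ≫ j = q ≫ c.pullFst π ≫ c.g ≫ j := by
      simpa only [Category.assoc] using congr_arg (· ≫ c.g ≫ j) h.symm
    rw [comp_lineMap_coord, h2]
    ring

variable [IsOpenImmersion j]

/-- The open subset of the product of the neighbourhood with `I` on which the straight line homotopy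
takes values in `Y`. -/
def cyl : (c.pull π).W.Opens := c.lineMap π T j ⁻¹ᵁ j.opensRange

include hj in
lemma supp_subset_cyl : (c.pull π).e ⁻¹' (c.pull π).Z ⊆ Set.range (c.cyl π T j).ι := by
  intro y hy
  rw [Scheme.Opens.range_ι]
  change c.lineMap π T j y ∈ Set.range j
  have h1 : c.pullFst π y ∈ Set.range c.suppPt := by
    rw [range_suppPt]
    change c.e (c.pullFst π y) ∈ c.Z
    rw [← Scheme.Hom.comp_apply, (c.pull_isPullback π).w]
    exact hy
  obtain ⟨x, hx⟩ := h1
  -- The line is known to be constant only along morphisms, so `y` is lifted to the scheme-theoretic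
  -- preimage of the support, where `comp_lineMap_of_supp` can be applied.
  obtain ⟨q, rfl, -⟩ := Scheme.Pullback.exists_preimage_pullback (f := c.pullFst π)
    (g := c.suppPt) y x hx.symm
  have hq := pullback.condition (f := c.pullFst π) (g := c.suppPt)
  have hq' : pullback.fst (c.pullFst π) c.suppPt ≫ c.cylProj π ≫ π.left =
      pullback.snd (c.pullFst π) c.suppPt := by
    rw [← pullFst_e_proj, reassoc_of% hq, suppPt_e_proj, Category.comp_id]
  have key := c.comp_lineMap_of_supp π T j hj (pullback.fst (c.pullFst π) c.suppPt) (by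
    rw [reassoc_of% hq', hq])
  rw [← Scheme.Hom.comp_apply, key]
  refine ⟨(pullback.fst (c.pullFst π) c.suppPt ≫ c.pullFst π ≫ c.g)
    q, ?_⟩
  rw [← Scheme.Hom.comp_apply]
  simp only [Category.assoc]

/-- The homotopy of maps to `Y`. -/
def cylMap : (c.cyl π T j).toScheme ⟶ Y.left :=
  IsOpenImmersion.lift j ((c.cyl π T j).ι ≫ c.lineMap π T j) (by
    rintro _ ⟨y, rfl⟩
    exact y.2)

lemma cylMap_j : c.cylMap π T j ≫ j = (c.cyl π T j).ι ≫ c.lineMap π T j :=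
  IsOpenImmersion.lift_fac _ _ _

omit [IsOpenImmersion j] in
-- The section used in the homotopy is pulled back from W and does not involve T or the matrix, so
-- its zero locus is always the preimage of Z.
lemma centred_zeroLocus_pull {Q : Scheme.{u}} (q : Q ⟶ (c.pull π).W)
    (F : Matrix (Fin n) (Fin N') Γ(Q, ⊤)) (hF : ∃ G : Matrix (Fin N') (Fin n) Γ(Q, ⊤), F * G = 1) :
    (TautMap.single F (fun i => (q ≫ c.pullFst π).appTop (c.centred i)) hF).zeroLocus =
      (q ≫ (c.pull π).e) ⁻¹' (c.pull π).Z := by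
  rw [TautMap.zeroLocus_single]
  ext y
  change _ ↔ affMap n π ((q ≫ (c.pull π).e) y) ∈ c.Z
  rw [← Scheme.Hom.comp_apply, Category.assoc, ← (c.pull_isPullback π).w, ← Category.assoc,
    Scheme.Hom.comp_apply, mem_Z_iff_centred]
  exact forall_congr' fun i => not_congr (mem_basicOpen_appTop _ _ _)

/-- The homotopy which moves the support to the origin and `g` to a constant map, with the quotient
given by the matrix `F`. -/
def homotopy (F : Matrix (Fin n) (Fin N') Γ((c.pull π).W, ⊤))
    (hF : ∃ G : Matrix (Fin N') (Fin n) Γ((c.pull π).W, ⊤), F * G = 1) :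
    ExplicitCob n N' I Y :=
  ((c.pull π).replace (c.cyl π T j).ι (c.supp_subset_cyl π T j hj)
    (.single (F.map (c.cyl π T j).ι.appTop.hom)
      (fun i => ((c.cyl π T j).ι ≫ c.pullFst π).appTop (c.centred i))
      (TautMap.exists_rightInverse_map _ hF))
    (c.centred_zeroLocus_pull π _ _ _)
    (c.cylMap π T j) (by
      rw [← hj, ← Category.assoc, cylMap_j, Category.assoc, lineMap_proj, cylProj]
      simp only [Category.assoc])).translate fun i => - (T * π.left.appTop (c.suppCoord i))

end homotopy

end ExplicitCob

/-! ### Paths of right invertible matrices. -/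

/-- The matrix `(A | C)`. -/
def colBlock {R : Type*} {n N r : ℕ} (A : Matrix (Fin n) (Fin N) R) (C : Matrix (Fin n) (Fin r) R) :
    Matrix (Fin n) (Fin (N + r)) R :=
  Matrix.of fun p => Fin.append (A p) (C p)

section colBlock

variable {R : Type*} [CommRing R] {n N r : ℕ}

omit [CommRing R] in
lemma colBlock_map {S : Type*} (f : R → S) (A : Matrix (Fin n) (Fin N) R)
    (C : Matrix (Fin n) (Fin r) R) : (colBlock A C).map f = colBlock (A.map f) (C.map f) := by
  ext p q
  refine Fin.addCases (fun q => ?_) (fun q => ?_) q <;> simp [colBlock]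

lemma padZero_colBlock (A : Matrix (Fin n) (Fin N) R) :
    padZero (colBlock A (0 : Matrix (Fin n) (Fin r) R)) =
      colBlock A (0 : Matrix (Fin n) (Fin (r + 1)) R) := by
  ext p q
  refine Fin.addCases (m := N) (n := r + 1) (fun q => ?_) (fun q => ?_) q
  · have : Fin.castAdd (r + 1) q = (Fin.castAdd r q).castSucc := rfl
    rw [this, padZero_castSucc, ← this]
    simp [colBlock]
  · refine Fin.lastCases ?_ (fun q => ?_) q
    · have h : Fin.natAdd N (Fin.last r) = Fin.last (N + r) := rfl
      have h' : colBlock A (0 : Matrix (Fin n) (Fin (r + 1)) R) p (Fin.natAdd N (Fin.last r)) = 0 := by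
        simp [colBlock, -Fin.natAdd_last]
      exact (padZero_last _ _).trans h'.symm
    · have : Fin.natAdd N q.castSucc = (Fin.natAdd N q).castSucc := rfl
      rw [this, padZero_castSucc, ← this]
      simp [colBlock]

omit [CommRing R] in
lemma colBlock_zero_right (A : Matrix (Fin n) (Fin N) R) (C : Matrix (Fin n) (Fin 0) R) :
    colBlock A C = A := by
  ext p q
  exact Fin.append_left (A p) (C p) q

/-- The right factor is the block matrix with A' above C', obtained from `colBlock` by
transposition. -/
lemma colBlock_mul (A : Matrix (Fin n) (Fin N) R) (C : Matrix (Fin n) (Fin r) R)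
    (A' : Matrix (Fin N) (Fin n) R) (C' : Matrix (Fin r) (Fin n) R) :
    colBlock A C * (colBlock A'.transpose C'.transpose).transpose = A * A' + C * C' := by
  ext p q
  rw [Matrix.mul_apply, Fin.sum_univ_add, Matrix.add_apply, Matrix.mul_apply, Matrix.mul_apply]
  simp [colBlock]

lemma exists_rightInverse_colBlock_zero {A : Matrix (Fin n) (Fin N) R}
    (hA : ∃ B : Matrix (Fin N) (Fin n) R, A * B = 1) :
    ∃ B : Matrix (Fin (N + r)) (Fin n) R, colBlock A (0 : Matrix (Fin n) (Fin r) R) * B = 1 := by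
  obtain ⟨B, hB⟩ := hA
  exact ⟨(colBlock B.transpose (0 : Matrix (Fin r) (Fin n) R).transpose).transpose,
    by rw [colBlock_mul, hB]; simp⟩

/-- The path `((1 - t) A + t B | t (1 - t))` of matrices from `(A | 0)` to `(B | 0)`. -/
def matrixPath (A B : Matrix (Fin n) (Fin N) R) (t : R) : Matrix (Fin n) (Fin (N + n)) R :=
  colBlock ((1 - t) • A + t • B) ((t * (1 - t)) • 1)

/-- The line from A to B alone may lose rank. With right inverses A' and B', the product ((1 - t)A +
tB)((1 - t)A' + tB') equals (1 - t)² + t² + t(1 - t)(AB' + BA'). The extra block t(1 - t), paired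
with 2 - AB' - BA', cancels the mixed terms and leaves (1 - t)² + t² + 2t(1 - t) = 1. -/
lemma exists_rightInverse_matrixPath {A B : Matrix (Fin n) (Fin N) R}
    (hA : ∃ A' : Matrix (Fin N) (Fin n) R, A * A' = 1)
    (hB : ∃ B' : Matrix (Fin N) (Fin n) R, B * B' = 1) (t : R) :
    ∃ G : Matrix (Fin (N + n)) (Fin n) R, matrixPath A B t * G = 1 := by
  obtain ⟨A', hA⟩ := hA
  obtain ⟨B', hB⟩ := hB
  refine ⟨(colBlock ((1 - t) • A' + t • B').transpose
    (2 - A * B' - B * A').transpose).transpose, ?_⟩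
  have h2 : (2 : Matrix (Fin n) (Fin n) R) = (2 : R) • 1 := by
    rw [two_smul, one_add_one_eq_two]
  rw [matrixPath, colBlock_mul, h2]
  simp only [Matrix.add_mul, Matrix.mul_add, Matrix.smul_mul, Matrix.mul_smul, hA, hB, smul_add,
    smul_sub, smul_smul, Matrix.one_mul]
  module

lemma matrixPath_map {S : Type*} [CommRing S] (f : R →+* S) (A B : Matrix (Fin n) (Fin N) R)
    (t : R) : (matrixPath A B t).map f = matrixPath (A.map f) (B.map f) (f t) := by
  rw [matrixPath, colBlock_map, matrixPath]
  congr 1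
  · ext p q; simp
  · ext p q
    by_cases h : p = q <;> simp [h]

lemma matrixPath_zero (A B : Matrix (Fin n) (Fin N) R) : matrixPath A B 0 = colBlock A 0 := by
  simp [matrixPath]

lemma matrixPath_one (A B : Matrix (Fin n) (Fin N) R) : matrixPath A B 1 = colBlock B 0 := by
  simp [matrixPath]

end colBlock

/-! ### The two ends of the homotopy. -/

namespace ExplicitCob

/-- The correspondence `c` is `(𝔸ⁿ, (B, x), f)`, up to an isomorphism of the neighbourhood. -/
structure IsStandard {S : Scheme.{u}} {n N : ℕ} {X Y : Over S} (c : ExplicitCob n N X Y)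
    (f : X ⟶ Y) (B : Matrix (Fin n) (Fin N) ℤ) : Prop where
  isIso : IsIso c.e
  mem_Z : ∀ y, y ∈ c.Z ↔
    ∀ i : Fin n, y ∉ (Aff n X.left).basicOpen (AffineSpace.coord X.left ⟨i⟩)
  φ : ∃ hB, c.φ = .single (B.map (Int.castRingHom Γ(c.W, ⊤)))
    (fun i => c.e.appTop (AffineSpace.coord X.left ⟨i⟩)) hB
  g : c.g = c.e ≫ affProj n X.left ≫ f.left

section endpoints

variable {S : Scheme.{u}} {n N N' m : ℕ} {X Y I D : Over S} (c : ExplicitCob n N X Y)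
  [IsIso (redι c.Z ≫ affProj n X.left)] (π : I ⟶ X) (T : Γ(I.left, ⊤))
  (j : Y.left ⟶ Aff m S) [IsOpenImmersion j] (hj : j ≫ affProj m S = Y.hom)
  (F : Matrix (Fin n) (Fin N') Γ((c.pull π).W, ⊤))
  (hF : ∃ G : Matrix (Fin N') (Fin n) Γ((c.pull π).W, ⊤), F * G = 1) (δ : D ⟶ I)

/-- The embedding of the neighbourhood of the homotopy in the product of the neighbourhood with `I`. -/
def homotopyι : (c.homotopy π T j hj F hF).W ⟶ (c.pull π).W := (c.cyl π T j).ι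

lemma homotopy_e : (c.homotopy π T j hj F hF).e = c.homotopyι π T j hj F hF ≫ (c.pull π).e ≫
    translation (fun i => - (T * π.left.appTop (c.suppCoord i))) :=
  Category.assoc (c.cyl π T j).ι _ _

lemma homotopy_φ : (c.homotopy π T j hj F hF).φ =
    .single (F.map (c.homotopyι π T j hj F hF).appTop.hom)
      (fun i => (c.homotopyι π T j hj F hF ≫ c.pullFst π).appTop (c.centred i))
      (TautMap.exists_rightInverse_map _ hF) := rfl

lemma homotopy_g : (c.homotopy π T j hj F hF).g ≫ j =
    c.homotopyι π T j hj F hF ≫ c.lineMap π T j :=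
  c.cylMap_j π T j

/-- The projection from a fibre of the homotopy to the product of the neighbourhood with `I`. -/
def fibreMap : ((c.homotopy π T j hj F hF).pull δ).W ⟶ (c.pull π).W :=
  (c.homotopy π T j hj F hF).pullFst δ ≫ c.homotopyι π T j hj F hF

lemma fibreMap_e : c.fibreMap π T j hj F hF δ ≫ (c.pull π).e ≫
    translation (fun i => - (T * π.left.appTop (c.suppCoord i))) =
      ((c.homotopy π T j hj F hF).pull δ).e ≫ affMap n δ := by
  rw [← ((c.homotopy π T j hj F hF).pull_isPullback δ).w, fibreMap, Category.assoc, homotopy_e]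

lemma fibreMap_cylProj : c.fibreMap π T j hj F hF δ ≫ c.cylProj π =
    ((c.homotopy π T j hj F hF).pull δ).e ≫ affProj n D.left ≫ δ.left := by
  have h := congr_arg (· ≫ affProj n I.left) (c.fibreMap_e π T j hj F hF δ)
  simp only [Category.assoc, translation_proj] at h
  rw [cylProj, h]
  congr 1
  exact AffineSpace.map_over _

/-- The ambient coordinates of the homotopy are x - Tz, with z the support: the original ones at T =
0, the centred ones at T = 1. -/
lemma fibre_coord (i : Fin n) :
    ((c.homotopy π T j hj F hF).pull δ).e.appTop (AffineSpace.coord D.left ⟨i⟩) =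
      (c.fibreMap π T j hj F hF δ ≫ c.pullFst π ≫ c.e).appTop (AffineSpace.coord X.left ⟨i⟩) -
      (c.fibreMap π T j hj F hF δ ≫ c.cylProj π).appTop T *
        (c.fibreMap π T j hj F hF δ ≫ c.cylProj π ≫ π.left).appTop (c.suppCoord i) := by
  have h1 : (affMap n δ).appTop (AffineSpace.coord I.left ⟨i⟩) = AffineSpace.coord D.left ⟨i⟩ :=
    AffineSpace.map_appTop_coord _ _
  have h2 : (affMap n π).appTop (AffineSpace.coord X.left ⟨i⟩) = AffineSpace.coord I.left ⟨i⟩ :=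
    AffineSpace.map_appTop_coord _ _
  rw [← h1, appTop_comp_apply, ← c.fibreMap_e, ← Category.assoc, ← appTop_comp_apply _ (translation _),
    translation_coord, ← h2, map_add, map_neg, map_neg, map_mul, map_mul, ← sub_eq_add_neg]
  simp only [appTop_comp_apply, Category.assoc, cylProj, (c.pull_isPullback π).w]

/-- After the translation the support sits at (1 - T)z, so it travels from z to the origin. -/
lemma mem_pullZ_homotopy (y : Aff n D.left) : y ∈ pullZ δ (c.homotopy π T j hj F hF).Z ↔
    ∀ i : Fin n, y ∉ (Aff n D.left).basicOpen (AffineSpace.coord D.left ⟨i⟩ -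
      (affProj n D.left).appTop ((1 - δ.left.appTop T) *
        (δ ≫ π).left.appTop (c.suppCoord i))) := by
  let q := affMap n δ ≫ translation (-fun i => - (T * π.left.appTop (c.suppCoord i))) ≫ affMap n π
  have hq : y ∈ pullZ δ (c.homotopy π T j hj F hF).Z ↔ q y ∈ c.Z := Iff.rfl
  have h1 (i : Fin n) : (affMap n δ).appTop (AffineSpace.coord I.left ⟨i⟩) =
    AffineSpace.coord D.left ⟨i⟩ := AffineSpace.map_appTop_coord _ _
  have h2 (i : Fin n) : (affMap n π).appTop (AffineSpace.coord X.left ⟨i⟩) =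
    AffineSpace.coord I.left ⟨i⟩ := AffineSpace.map_appTop_coord _ _
  have h3 : affMap n δ ≫ affProj n I.left = affProj n D.left ≫ δ.left := AffineSpace.map_over _
  have h4 : affMap n π ≫ affProj n X.left = affProj n I.left ≫ π.left := AffineSpace.map_over _
  have hq2 : q ≫ affProj n X.left = affProj n D.left ≫ δ.left ≫ π.left := by
    simp only [q, Category.assoc, h4]
    rw [← Category.assoc (translation _), translation_proj, reassoc_of% h3]
  rw [hq, mem_Z_iff]
  refine forall_congr' fun i => not_congr ?_
  rw [← mem_basicOpen_appTop]
  have key : q.appTop (AffineSpace.coord X.left ⟨i⟩) = AffineSpace.coord D.left ⟨i⟩ +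
      (affProj n D.left).appTop (δ.left.appTop T * (δ ≫ π).left.appTop (c.suppCoord i)) := by
    have e1 : q.appTop (AffineSpace.coord X.left ⟨i⟩) =
      (affMap n δ).appTop ((translation (-fun i => - (T * π.left.appTop (c.suppCoord i)))).appTop
        ((affMap n π).appTop (AffineSpace.coord X.left ⟨i⟩))) := by
      simp only [appTop_comp_apply, q]
    rw [e1, h2, translation_coord, map_add, h1, Pi.neg_apply, neg_neg, appTop_comp_apply, h3,
      ← appTop_comp_apply, map_mul, appTop_comp_apply]
    rfl
  rw [map_sub, key, appTop_comp_apply, hq2, sub_mul, one_mul, map_sub, ← sub_add, add_sub_right_comm,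
    appTop_comp_apply]
  rfl

variable (f₂ : D ⟶ X) (hf₂ : f₂ = δ ≫ π)

include hf₂ in
-- At T = 0 the translation is trivial and the line is at g, so the fibre maps to W as an étale
-- neighbourhood. The matrix enters only through its restriction to T = 0, which is what `hFA`
-- controls. Keeping `f₂` separate lets both ends be pulled back along the same morphism.
lemma homotopy_zero (hT : δ.left.appTop T = 0) (A : Matrix (Fin n) (Fin N') Γ(c.W, ⊤))
    (hA : ∃ G : Matrix (Fin N') (Fin n) Γ(c.W, ⊤), A * G = 1)
    (hz : (TautMap.single A c.centred hA).zeroLocus = c.φ.zeroLocus)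
    (hFA : ∀ {Q : Scheme.{u}} (q : Q ⟶ (c.pull π).W), (q ≫ c.cylProj π).appTop T = 0 →
      F.map q.appTop.hom = A.map (q ≫ c.pullFst π).appTop.hom) :
    ((c.homotopy π T j hj F hF).pull δ).Equivalent ((c.reframe (.single A c.centred hA) hz).pull f₂) := by
  subst hf₂
  have hT' : (c.fibreMap π T j hj F hF δ ≫ c.cylProj π).appTop T = 0 := by
    rw [fibreMap_cylProj, ← appTop_comp_apply, ← appTop_comp_apply, hT, map_zero, map_zero]
  refine pull_equivalent_pull δ (δ ≫ π) _ _ (c.fibreMap π T j hj F hF δ ≫ c.pullFst π) ?_ ?_ ?_ ?_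
  · change (c.fibreMap π T j hj F hF δ ≫ c.pullFst π) ≫ c.e = _
    refine AffineSpace.hom_ext ?_ fun i => ?_
    · have h := AffineSpace.map_over (n := ULift.{u} (Fin n)) (δ ≫ π).left
      have h1 := c.pullFst_e_proj π
      have h2 := c.fibreMap_cylProj π T j hj F hF δ
      simp only [Category.assoc, h1, h, reassoc_of% h2, Over.comp_left]
    · obtain ⟨i⟩ := i
      have h := AffineSpace.map_appTop_coord (n := ULift.{u} (Fin n)) (δ ≫ π).left ⟨i⟩
      rw [← appTop_comp_apply _ (affMap n (δ ≫ π)), h, fibre_coord, hT', zero_mul, sub_zero,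
        Category.assoc]
  · ext y
    refine (c.mem_pullZ_homotopy π T j hj F hF δ y).trans ?_
    change _ ↔ affMap n (δ ≫ π) y ∈ c.Z
    rw [mem_Z_iff]
    refine forall_congr' fun i => not_congr ?_
    have h := AffineSpace.map_over (n := ULift.{u} (Fin n)) (δ ≫ π).left
    have h1 := AffineSpace.map_appTop_coord (n := ULift.{u} (Fin n)) (δ ≫ π).left ⟨i⟩
    rw [← mem_basicOpen_appTop, map_sub, h1, appTop_comp_apply, h, hT, sub_zero, one_mul,
      appTop_comp_apply]
  · refine .of_eq ?_
    rw [pull_φ, homotopy_φ, TautMap.pull_single]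
    refine (TautMap.single_congr _ ?_ ?_).trans (TautMap.pull_single _ A c.centred hA).symm
    · refine Eq.trans ?_ (hFA (c.fibreMap π T j hj F hF δ) hT')
      ext p q
      exact appTop_comp_apply _ _ _
    · funext i
      have e : (c.homotopy π T j hj F hF).pullFst δ ≫ c.homotopyι π T j hj F hF ≫ c.pullFst π =
        c.fibreMap π T j hj F hF δ ≫ c.pullFst π := (Category.assoc _ _ _).symm
      exact (appTop_comp_apply _ _ _).trans
        (congr_arg (fun f : _ ⟶ c.W => f.appTop (c.centred i)) e)
  · change _ = (c.fibreMap π T j hj F hF δ ≫ c.pullFst π) ≫ c.g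
    rw [← cancel_mono j, pull_g, Category.assoc, homotopy_g, ← Category.assoc]
    refine (c.comp_lineMap_of_zero π T j hj (c.fibreMap π T j hj F hF δ) hT').trans ?_
    simp only [Category.assoc]

include hf₂ in
-- At T = 1 the matrix and the map to Y are constant and the section consists of the ambient
-- coordinates, so all data come from affine space. The fibre is merely a smaller étale
-- neighbourhood than the one of `c'`.
lemma homotopy_one (hT : δ.left.appTop T = 1) (c' : ExplicitCob n N' X Y)
    {B : Matrix (Fin n) (Fin N') ℤ} (hc' : c'.IsStandard c.restrictToSupport B)
    (hFB : ∀ {Q : Scheme.{u}} (q : Q ⟶ (c.pull π).W), (q ≫ c.cylProj π).appTop T = 1 →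
      F.map q.appTop.hom = B.map (Int.castRingHom Γ(Q, ⊤))) :
    ((c.homotopy π T j hj F hF).pull δ).Equivalent (c'.pull f₂) := by
  subst hf₂
  have hT' : (c.fibreMap π T j hj F hF δ ≫ c.cylProj π).appTop T = 1 := by
    rw [fibreMap_cylProj, ← appTop_comp_apply, ← appTop_comp_apply, hT, map_one, map_one]
  have := hc'.isIso
  -- As `c'.e` is an isomorphism, the étale map of the fibre itself provides the comparison with the
  -- neighbourhood of `c'`.
  have hi : (((c.homotopy π T j hj F hF).pull δ).e ≫ affMap n (δ ≫ π) ≫ inv c'.e) ≫ c'.e =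
      ((c.homotopy π T j hj F hF).pull δ).e ≫ affMap n (δ ≫ π) := by simp
  refine pull_equivalent_pull δ (δ ≫ π) _ _ _ hi ?_ ?_ ?_
  · ext y
    refine (c.mem_pullZ_homotopy π T j hj F hF δ y).trans ?_
    change _ ↔ affMap n (δ ≫ π) y ∈ c'.Z
    rw [hc'.mem_Z]
    refine forall_congr' fun i => not_congr ?_
    have h1 := AffineSpace.map_appTop_coord (n := ULift.{u} (Fin n)) (δ ≫ π).left ⟨i⟩
    rw [← mem_basicOpen_appTop, h1, hT, sub_self, zero_mul, map_zero, sub_zero]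
  · refine .of_eq ?_
    obtain ⟨hB, hφ⟩ := hc'.φ
    rw [hφ, pull_φ, homotopy_φ, TautMap.pull_single, TautMap.pull_single]
    refine TautMap.single_congr _ ?_ ?_
    · have h1 : (F.map (c.homotopyι π T j hj F hF).appTop.hom).map
          ((c.homotopy π T j hj F hF).pullFst δ).appTop.hom =
          F.map (c.fibreMap π T j hj F hF δ).appTop.hom := by
        ext p q
        exact appTop_comp_apply _ _ _
      rw [h1, hFB _ hT']
      ext p q
      simp
    · funext i
      have h := AffineSpace.map_appTop_coord (n := ULift.{u} (Fin n)) (δ ≫ π).left ⟨i⟩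
      rw [appTop_comp_apply, appTop_comp_apply, hi, ← appTop_comp_apply _ (affMap n (δ ≫ π)), h,
        fibre_coord, hT', one_mul, centred, map_sub, appTop_comp_apply, appTop_comp_apply,
        fibreMap]
      simp only [Category.assoc, pullFst_e_proj]
  · rw [← cancel_mono j, pull_g, Category.assoc, homotopy_g, hc'.g]
    refine (Category.assoc _ _ _).symm.trans
      ((c.comp_lineMap_of_one π T j hj (c.fibreMap π T j hj F hF δ) hT').trans ?_)
    have h := AffineSpace.map_over (n := ULift.{u} (Fin n)) (δ ≫ π).left
    have h2 := c.fibreMap_cylProj π T j hj F hF δ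
    simp only [Category.assoc, reassoc_of% h, ← suppPt_g, reassoc_of% h2, Over.comp_left,
      IsIso.inv_hom_id_assoc]

end endpoints

end ExplicitCob

/-! ### Standard correspondences and stabilisation. -/

namespace ExplicitCob

section standard

variable {S : Scheme.{u}} {n N : ℕ} {X Y : Over S} {f : X ⟶ Y}

lemma isStandard_ofMap (f : X ⟶ Y) : (ofMap f).IsStandard f 0 where
  isIso := by
    change IsIso (𝟙 (Aff 0 X.left))
    infer_instance
  mem_Z y := ⟨fun _ i => i.elim0, fun _ => trivial⟩
  φ := ⟨⟨0, Subsingleton.elim _ _⟩, TautMap.single_congr (W := Aff 0 X.left) ⟨0, Subsingleton.elim _ _⟩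
    (Subsingleton.elim _ _) (Subsingleton.elim _ _)⟩
  g := (Category.id_comp _).symm

lemma IsStandard.stabLast {c : ExplicitCob n N X Y} {B : Matrix (Fin n) (Fin N) ℤ}
    (h : c.IsStandard f B) : c.stabLast.IsStandard f (padZero B) where
  isIso := h.isIso
  mem_Z := h.mem_Z
  φ := by
    obtain ⟨hB, hφ⟩ := h.φ
    have e : (padZero B).map (Int.castRingHom Γ(c.W, ⊤)) =
      padZero (B.map (Int.castRingHom Γ(c.W, ⊤))) := padZero_map _ _
    refine ⟨e ▸ padZero_epi hB, ?_⟩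
    change c.φ.stabLast = _
    rw [hφ, TautMap.stabLast_single]
    exact TautMap.single_congr _ e.symm rfl
  g := h.g

lemma IsStandard.stabFirst {c : ExplicitCob n N X Y} {B : Matrix (Fin n) (Fin N) ℤ}
    (h : c.IsStandard f B) : c.stabFirst.IsStandard f (blockOne B) where
  isIso := by
    have := h.isIso
    change IsIso (pullback.snd c.e (dropFirst n X.left))
    infer_instance
  mem_Z y := by
    change dropFirst n X.left y ∈ c.Z ∧ y ∉ (Aff (n + 1) X.left).basicOpen (firstCoord n X.left) ↔ _
    rw [h.mem_Z, Fin.forall_fin_succ, and_comm]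
    refine and_congr Iff.rfl (forall_congr' fun i => not_congr ?_)
    rw [← mem_basicOpen_appTop, dropFirst_coord]
  φ := by
    obtain ⟨hB, hφ⟩ := h.φ
    have e : (blockOne B).map (Int.castRingHom Γ(c.stabFirst.W, ⊤)) =
      blockOne ((B.map (Int.castRingHom Γ(c.W, ⊤))).map c.stabFst.appTop.hom) := by
        rw [blockOne_map]
        congr 1
        ext p q
        simp
    have hB' := (LocalQuot.stabFirst (c.stabFirst.e.appTop (firstCoord n X.left))
      ⟨⊤, _, fun i => c.stabFst.appTop (c.e.appTop (AffineSpace.coord X.left ⟨i⟩)),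
        TautMap.exists_rightInverse_map c.stabFst.appTop.hom hB⟩).epi
    refine ⟨e ▸ hB', ?_⟩
    rw [stab_φ, hφ, TautMap.pull_single, TautMap.stabFirst_single]
    refine TautMap.single_congr _ e.symm (funext fun i => ?_)
    refine Fin.cases rfl (fun i => ?_) i
    rw [Fin.cons_succ, appTop_comp_apply, c.stab_isPullback.w, ← appTop_comp_apply, dropFirst_coord]
  g := by
    rw [stab_g, h.g, c.stab_isPullback.w_assoc]
    have := dropFirst_proj n X.left
    rw [reassoc_of% this]

/-- The n-fold stabilisation in the first direction adds one coordinate and one diagonal entry 1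
each time. The matrix is kept integral so that it has an image in every ring of functions,
compatible with all pull-backs. -/
lemma exists_isStandard_square (f : X ⟶ Y) (n : ℕ) : ∃ (c : ExplicitCob n n X Y)
    (B : Matrix (Fin n) (Fin n) ℤ), (∃ B', B * B' = 1) ∧ c.IsStandard f B ∧
      ZF.cls c = ZF.cls (ofMap f) := by
  induction n with
  | zero => exact ⟨ofMap f, 0, ⟨0, Subsingleton.elim _ _⟩, isStandard_ofMap f, rfl⟩
  | succ n ih =>
    obtain ⟨c, B, ⟨B', hB⟩, hc, he⟩ := ih
    exact ⟨c.stabFirst, blockOne B, ⟨blockOne B', by rw [← blockOne_mul, hB, blockOne_one]⟩,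
      hc.stabFirst, (ZF.cls_stabFirst c).trans he⟩

lemma IsStandard.exists_colBlock {c : ExplicitCob n N X Y} {B : Matrix (Fin n) (Fin N) ℤ}
    (h : c.IsStandard f B) (r : ℕ) : ∃ c' : ExplicitCob n (N + r) X Y,
      c'.IsStandard f (colBlock B 0) ∧ ZF.cls c' = ZF.cls c := by
  induction r with
  | zero => exact ⟨c, by rwa [colBlock_zero_right], rfl⟩
  | succ r ih =>
    obtain ⟨c', h', he⟩ := ih
    exact ⟨c'.stabLast, by rw [← padZero_colBlock]; exact h'.stabLast,
      (ZF.cls_stabLast c').trans he⟩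

/-- Adding r zero columns is r-fold stabilisation in N. This makes room for the auxiliary block of
`matrixPath`. -/
lemma cls_reframe_colBlock (c : ExplicitCob n N X Y) (A : Matrix (Fin n) (Fin N) Γ(c.W, ⊤))
    (v : Fin n → Γ(c.W, ⊤)) (hA : ∃ B : Matrix (Fin N) (Fin n) Γ(c.W, ⊤), A * B = 1)
    (hφ : c.φ = .single A v hA) (r : ℕ) (hr hz) :
    ZF.cls (c.reframe (N' := N + r) (.single (colBlock A 0) v hr) hz) = ZF.cls c := by
  induction r with
  | zero =>
    refine congr_arg ZF.cls ?_
    have e : TautMap.single (colBlock A (0 : Matrix (Fin n) (Fin 0) Γ(c.W, ⊤))) v hr = c.φ := by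
      rw [hφ]
      exact TautMap.single_congr _ (colBlock_zero_right _ _) rfl
    -- The proof `hz` depends on the map to τ, so it is generalised before that map is rewritten.
    revert hz
    rw [e]
    intro _
    rfl
  | succ r ih =>
    have hr' := exists_rightInverse_colBlock_zero (r := r) hA
    have e : TautMap.single (colBlock A (0 : Matrix (Fin n) (Fin (r + 1)) Γ(c.W, ⊤))) v hr =
        (TautMap.single (colBlock A (0 : Matrix (Fin n) (Fin r) Γ(c.W, ⊤))) v hr').stabLast := by
      rw [TautMap.stabLast_single]
      exact (TautMap.single_congr _ (padZero_colBlock A) rfl).symm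
    revert hz
    change ∀ hz, ZF.cls (c.reframe (N' := N + r + 1) _ hz) = _
    rw [e]
    intro hz
    exact (ZF.cls_stabLast (c.reframe (.single (colBlock A 0) v hr') hz)).trans (ih hr' hz)

end standard

end ExplicitCob

/-! ### The coordinate t₁ on Δ¹ and its values at the two vertices. -/

section interval

variable (k : Type u) [Field k]

/-- The coordinate `t₁` on the algebraic 1-simplex. -/
def intervalCoord : Γ(((simplex k).obj (.mk 1)).left, ⊤) :=
  (Scheme.ΓSpecIso (.of (simplexRing k 1))).inv (simplexRing.t k 1)

lemma δ_intervalCoord (i : Fin 2) :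
    ((simplex k).map (SimplexCategory.δ (n := 0) i)).left.appTop (intervalCoord k) =
      (Scheme.ΓSpecIso (.of (simplexRing k 0))).inv
        (simplexRing.map k (SimplexCategory.δ (n := 0) i).toOrderHom (simplexRing.t k 1)) := by
  have h := Scheme.ΓSpecIso_inv_naturality (CommRingCat.ofHom
    (simplexRing.map k (SimplexCategory.δ (n := 0) i).toOrderHom :
      simplexRing k 1 →+* simplexRing k 0))
  exact (congr($(h).hom (simplexRing.t k 1))).symm

lemma δ_zero_intervalCoord :
    ((simplex k).map (SimplexCategory.δ (n := 0) 0)).left.appTop (intervalCoord k) = 1 := by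
  rw [δ_intervalCoord, simplexRing.map_t]
  -- The coface δ 0 omits vertex 0, so it hits vertex 1, where t₁ = 1; dually δ 1 gives t₁ = 0.
  have h : (Finset.univ.filter fun i : Fin 1 =>
      (SimplexCategory.δ (n := 0) 0).toOrderHom i = (1 : Fin 2)) = Finset.univ := by
    ext i; fin_cases i; simp [SimplexCategory.δ]
  have h' := simplexRing.sum_t k 0
  erw [h, h', map_one]
  rfl

lemma δ_one_intervalCoord :
    ((simplex k).map (SimplexCategory.δ (n := 0) 1)).left.appTop (intervalCoord k) = 0 := by
  rw [δ_intervalCoord, simplexRing.map_t]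
  have h : (Finset.univ.filter fun i : Fin 1 =>
      (SimplexCategory.δ (n := 0) 1).toOrderHom i = (1 : Fin 2)) = ∅ := by
    ext i; fin_cases i; simp [SimplexCategory.δ]
  erw [h, Finset.sum_empty, map_zero]
  rfl

/-- The projection of the algebraic 1-simplex to the point. -/
def intervalToPt : (simplex k).obj (.mk 1) ⟶ pt k := Over.homMk (((simplex k).obj (.mk 1)).hom)

lemma δ_intervalToPt (i : Fin 2) :
    simplexToPt = (simplex k).map (SimplexCategory.δ (n := 0) i) ≫ intervalToPt k :=
  Over.OverMorphism.ext (Over.w ((simplex k).map (SimplexCategory.δ (n := 0) i))).symm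

end interval

/-- A left inverse makes B an injection from Rⁿ to R^N, which over a nontrivial commutative ring
forces n ≤ N. -/
lemma le_of_mul_eq_one {R : Type*} [CommRing R] [Nontrivial R] {n N : ℕ}
    {A : Matrix (Fin n) (Fin N) R} {B : Matrix (Fin N) (Fin n) R} (h : A * B = 1) : n ≤ N := by
  refine le_of_fin_injective R B.mulVecLin fun x y hxy => ?_
  have := congr_arg A.mulVec hxy
  simpa [Matrix.mulVec_mulVec, h] using this

/-! ### Comparison with the level-0 correspondence. -/

section final

variable {k : Type u} [Field k] {n N m : ℕ} {Y : Over (base k)}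

lemma h0Class_eq_of_single (j : Y.left ⟶ Aff m (base k)) [IsOpenImmersion j]
    (hj : j ≫ affProj m (base k) = Y.hom) (c : ExplicitCob n N (pt k) Y)
    [IsIso (redι c.Z ≫ affProj n (pt k).left)] (A : Matrix (Fin n) (Fin N) Γ(c.W, ⊤))
    (hA : ∃ B : Matrix (Fin N) (Fin n) Γ(c.W, ⊤), A * B = 1)
    (hφ : c.φ = .single A c.centred hA) (hnN : n ≤ N) :
    h0Class c = h0Class (ExplicitCob.ofMap c.restrictToSupport) := by
  obtain ⟨d, rfl⟩ := Nat.exists_eq_add_of_le hnN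
  -- With N = n + d, the levels of `c₁`, `c₂`, `c₃` are (n, n), (n, N) and (n, N + n); the last n
  -- columns match the auxiliary block of the path.
  obtain ⟨c₁, B₁, ⟨B₁', hB₁⟩, hc₁, he₁⟩ :=
    ExplicitCob.exists_isStandard_square c.restrictToSupport n
  obtain ⟨c₂, hc₂, he₂⟩ := hc₁.exists_colBlock d
  obtain ⟨c₃, hc₃, he₃⟩ := hc₂.exists_colBlock n
  have hr := exists_rightInverse_colBlock_zero (r := n) hA
  have hz : (TautMap.single (colBlock A (0 : Matrix (Fin n) (Fin n) Γ(c.W, ⊤))) c.centred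
    hr).zeroLocus = c.φ.zeroLocus := by rw [hφ, TautMap.zeroLocus_single, TautMap.zeroLocus_single]
  have he := c.cls_reframe_colBlock A c.centred hA hφ n hr hz
  let π := intervalToPt k
  let T := intervalCoord k
  let B := colBlock B₁ (0 : Matrix (Fin n) (Fin d) ℤ)
  let F := matrixPath (A.map (c.pullFst π).appTop.hom)
    (B.map (Int.castRingHom Γ((c.pull π).W, ⊤))) ((c.cylProj π).appTop T)
  have hF := exists_rightInverse_matrixPath
    (TautMap.exists_rightInverse_map (c.pullFst π).appTop.hom hA)
    (TautMap.exists_rightInverse_map (Int.castRingHom Γ((c.pull π).W, ⊤))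
      (exists_rightInverse_colBlock_zero (r := d) ⟨B₁', hB₁⟩)) ((c.cylProj π).appTop T)
  -- The path is natural in the ring, so on a fibre it is evaluated at the value of T there.
  have hFq {Q : Scheme.{u}} (q : Q ⟶ (c.pull π).W) : F.map q.appTop.hom =
      matrixPath (A.map (q ≫ c.pullFst π).appTop.hom) (B.map (Int.castRingHom Γ(Q, ⊤)))
        ((q ≫ c.cylProj π).appTop T) := by
    refine (matrixPath_map q.appTop.hom _ _ _).trans ?_
    have e1 : (A.map (c.pullFst π).appTop.hom).map q.appTop.hom =
        A.map (q ≫ c.pullFst π).appTop.hom := by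
      ext p r
      exact appTop_comp_apply _ _ _
    have e2 : (B.map (Int.castRingHom Γ((c.pull π).W, ⊤))).map q.appTop.hom =
        B.map (Int.castRingHom Γ(Q, ⊤)) := by
      ext p r
      simp
    have e3 : q.appTop.hom ((c.cylProj π).appTop T) = (q ≫ c.cylProj π).appTop T :=
      appTop_comp_apply _ _ _
    rw [e1, e2, e3]
  -- The face δ 1 is the end T = 0 and the face δ 0 the end T = 1.
  have h0 := ZF.cls_eq_of_equivalent (c.homotopy_zero π T j hj F hF _ simplexToPt
    (δ_intervalToPt k 1) (δ_one_intervalCoord k) _ hr hz fun q hq => by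
      rw [hFq, hq, matrixPath_zero, colBlock_map, Matrix.map_zero _ (map_zero _)])
  have h1 := ZF.cls_eq_of_equivalent (c.homotopy_one π T j hj F hF _ simplexToPt
    (δ_intervalToPt k 0) (δ_zero_intervalCoord k) c₃ hc₃ fun q hq => by
      rw [hFq, hq, matrixPath_one]
      exact ((colBlock_map _ B 0).trans (by rw [Matrix.map_zero _ (map_zero _)])).symm)
  have h := toH0_pull_δ Y (ZF.cls (c.homotopy π T j hj F hF))
  rw [ZF.pull_cls, ZF.pull_cls, h0, h1, ← ZF.pull_cls, ← ZF.pull_cls, he, he₃, he₂, he₁] at h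
  exact h.symm

end final

end CobFramed

end

theorem mainTheorem6 {k : Type u} [Field k] [CharZero k] {m : ℕ} (Y : Over (base k))
    (j : Y.left ⟶ Aff m (base k)) [IsOpenImmersion j] (hj : j ≫ affProj m (base k) = Y.hom)
    {n N : ℕ} (c : ExplicitCob n N (pt k) Y)
    [IsIso (redι c.Z ≫ affProj n (pt k).left)] (hc : c.IsTransverse) :
    h0Class c = h0Class (ExplicitCob.ofMap c.restrictToSupport) := by
  obtain ⟨V, hV, A, hA, hs⟩ := c.exists_single hc
  have hV' : c.e ⁻¹' c.Z ⊆ Set.range V.ι := by rwa [Scheme.Opens.range_ι]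
  have hg : (V.ι ≫ c.g) ≫ Y.hom = (V.ι ≫ c.e) ≫ affProj n (pt k).left ≫ (pt k).hom := by
    rw [Category.assoc, c.g_over, Category.assoc]
  let c₀ := c.replace V.ι hV' (.single A (fun p => V.ι.appTop (c.centred p)) hA)
    (by rw [← hs.zeroLocus_eq, TautMap.zeroLocus_pull, c.zero]; rfl) (V.ι ≫ c.g) hg
  have hc₀ : c₀.Equivalent c := c.replace_equivalent V.ι hV' _ _ hs.symm hg
  have inst : IsIso (redι c₀.Z ≫ affProj n (pt k).left) :=
    inferInstanceAs (IsIso (redι c.Z ≫ affProj n (pt k).left))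
  -- Shrinking W changes neither the rational point nor, therefore, the value of g there, by
  -- uniqueness of the lift over Z.
  have hpt : c₀.suppPt ≫ V.ι = c.suppPt := by
    have h : c₀.zToW ≫ V.ι = c.zToW := by
      have := c.eq_zToW (c₀.zToW ≫ V.ι) (𝟙 _)
        ((Category.assoc _ _ _).trans (c₀.zToW_e.trans (Category.id_comp _).symm))
      exact this.trans (Category.id_comp _)
    have := congr_arg (fun f => inv (redι c.Z ≫ affProj n (pt k).left) ≫ f) h
    exact (Category.assoc _ _ _).trans this
  have hrestr : c₀.restrictToSupport = c.restrictToSupport := by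
    refine Over.OverMorphism.ext ?_
    rw [← c₀.suppPt_g, ← c.suppPt_g, ← hpt]
    exact (Category.assoc _ _ _).symm
  have hcentred : c₀.centred = fun p => V.ι.appTop (c.centred p) := by
    funext i
    have hcoord : c₀.suppCoord i = c.suppCoord i :=
      congr_arg (fun f : _ ⟶ Aff n (pt k).left => f.appTop (AffineSpace.coord (pt k).left ⟨i⟩))
        ((c₀.suppPt_e).trans c.suppPt_e.symm)
    rw [ExplicitCob.centred, ExplicitCob.centred, hcoord, map_sub, appTop_comp_apply,
      appTop_comp_apply]
    rfl
  let A₀ : Matrix (Fin n) (Fin N) Γ(c₀.W, ⊤) := A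
  have hA₀ : ∃ B : Matrix (Fin N) (Fin n) Γ(c₀.W, ⊤), A₀ * B = 1 := hA
  -- V contains the support point, so its ring of functions is nontrivial and the ranks can be
  -- compared.
  have hnN : n ≤ N := by
    obtain ⟨B, hB⟩ := hA
    have : Nonempty (base k) := inferInstance
    obtain ⟨y⟩ := this
    have : Nonempty (⊤ : V.toScheme.Opens) := ⟨⟨c₀.suppPt y, trivial⟩⟩
    exact le_of_mul_eq_one hB
  have key := h0Class_eq_of_single j hj c₀ A₀ hA₀
    (TautMap.single_congr hA rfl hcentred.symm) hnN
  rw [hrestr] at key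
  rw [← key]
  exact congr_arg (fun a => toH0 Y (ZF.pull simplexToPt a)) (ZF.cls_eq_of_equivalent hc₀).symm
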